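/- Let $R$ be a $\mathbb Z$-augmented $\lambda$-ring, that is, a (special) $\lambda$-ring with a ring homomorphism $\epsilon\colon R\to\mathbb Z$ such that $\epsilon(\lambda^n(y))=\binom{\epsilon(y)}{n}$ for all $n\ge 0$ and $y\in R$. Write $\gamma_t(y)=\sum_i\gamma^i(y)t^i:=\lambda_{t/(1-t)}(y)$, and for $q\ge 0$ let $\mathrm{Fil}^q_\gamma\subseteq R$ be the subgroup generated by all products $\gamma^{i_1}(x_1)\cdots\gamma^{i_p}(x_p)$ with $\epsilon(x_j)=0$ for all $j$ and $i_1+\dots+i_p\ge q$. Let $d\ge 0$ and $n\ge 1$ be integers. There is a unique integral polynomial $Q_{d,n}$ in variables standing for $\lambda^1(N),\dots,\lambda^d(N)$ and $\lambda^1(x),\lambda^2(x),\dots$ such that, in every $\lambda$-ring $A$, for all $N\in A$ with $\lambda^k(N)=0$ for $k>d$ and all $x\in A$, the element $\lambda^n(N,x):=Q_{d,n}(\lambda^1(N),\dots,\lambda^d(N);\lambda^1(x),\lambda^2(x),\dots)$ satisfies $$\lambda^n\bigl(x\,\lambda_{-1}(N)\bigr)=\lambda^n(N,x)\,\lambda_{-1}(N),\qquad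 \lambda_{-1}(N)=\sum_{i=0}^d(-1)^i\lambda^i(N).$$ Let $N\in R$ satisfy $\lambda^k(N)=0$ for all $k>d$ and $\epsilon(N)=d$, let $q\ge 0$ with $q+d\ge 1$, and let $x\in\mathrm{Fil}^q_\gamma$. Then for every $n\ge 1$ $$\lambda^n(N,x)+(-1)^n n^{q+d-1}x\in\mathrm{Fil}^{q+1}_\gamma .$$ -/

import Mathlib

universe u

/-! ### The universal polynomials of the theory of λ-rings -/

namespace LambdaRing

/-- The coefficient of `T ^ n` in `∏_{i, j ≤ n} (1 + x_i y_j T)`, where `x_i` is the variable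
`Sum.inl i` and `y_j` is the variable `Sum.inr j`. -/
noncomputable def prodSymm (n : ℕ) : MvPolynomial (Fin n ⊕ Fin n) ℤ :=
  (∏ i : Fin n, ∏ j : Fin n,
    (1 + Polynomial.C (MvPolynomial.X (Sum.inl i) * MvPolynomial.X (Sum.inr j)) *
      Polynomial.X)).coeff n

/-- `P(e_1(x), …, e_n(x); e_1(y), …, e_n(y))` is the coefficient of `T ^ n` in
`∏_{i, j ≤ n} (1 + x_i y_j T)`. This determines `P`. -/
def IsMulPoly (n : ℕ) (P : MvPolynomial (Fin n ⊕ Fin n) ℤ) : Prop :=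
  MvPolynomial.aeval (Sum.elim
    (fun i : Fin n => MvPolynomial.rename Sum.inl (MvPolynomial.esymm (Fin n) ℤ (i + 1)))
    (fun j : Fin n => MvPolynomial.rename Sum.inr (MvPolynomial.esymm (Fin n) ℤ (j + 1)))) P
    = prodSymm n

/-- The coefficient of `T ^ n` in `∏_{i_1 < ⋯ < i_m ≤ n m} (1 + x_{i_1} ⋯ x_{i_m} T)`. -/
noncomputable def compSymm (n m : ℕ) : MvPolynomial (Fin (n * m)) ℤ :=
  (∏ s ∈ Finset.powersetCard m (Finset.univ : Finset (Fin (n * m))),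
    (1 + Polynomial.C (∏ i ∈ s, MvPolynomial.X i) * Polynomial.X)).coeff n

/-- `P(e_1(x), …, e_{nm}(x))` is the coefficient of `T ^ n` in
`∏_{i_1 < ⋯ < i_m ≤ n m} (1 + x_{i_1} ⋯ x_{i_m} T)`. This determines `P`. -/
def IsCompPoly (n m : ℕ) (P : MvPolynomial (Fin (n * m)) ℤ) : Prop :=
  MvPolynomial.aeval (fun i : Fin (n * m) => MvPolynomial.esymm (Fin (n * m)) ℤ (i + 1)) P
    = compSymm n m

theorem exists_isCompPoly (n m : ℕ) : ∃ P, IsCompPoly n m P := by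
  have hs : (compSymm n m).IsSymmetric := by
    intro e
    unfold compSymm
    rw [← AlgHom.coe_toRingHom, ← Polynomial.coeff_map, Polynomial.map_prod]
    congr 1
    refine Finset.prod_bij (fun s _ => s.map e.toEmbedding) ?_ ?_ ?_ ?_
    · intro s hs
      simpa [Finset.mem_powersetCard] using hs
    · intro s _ t _ h
      exact Finset.map_injective _ h
    · intro t ht
      refine ⟨t.map e.symm.toEmbedding, ?_, ?_⟩
      · simpa [Finset.mem_powersetCard] using ht
      · ext x
        simp
    · intro s _
      simp [Polynomial.map_prod, map_prod, Finset.prod_map]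
  obtain ⟨P, hP⟩ := (MvPolynomial.esymmAlgEquiv (Fin (n * m)) ℤ (n := n * m) (by simp)).surjective
    ⟨_, hs⟩
  refine ⟨P, ?_⟩
  have := congrArg Subtype.val hP
  rw [MvPolynomial.esymmAlgEquiv_apply] at this
  rw [MvPolynomial.esymmAlgHom_apply] at this
  exact this

theorem exists_isMulPoly (n : ℕ) : ∃ P, IsMulPoly n P := by
  -- Over the coefficient ring `ℤ[σ_1, …, σ_n]`, with `σ_j` standing for `e_j(y)`, the product is
  -- `∏_i (1 + ∑_j σ_j x_i ^ j T ^ j)`, which is symmetric in the `x_i`.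
  let F : Polynomial (MvPolynomial (Fin n) (MvPolynomial (Fin n) ℤ)) :=
    ∏ i : Fin n, (1 + ∑ j : Fin n,
      Polynomial.C (MvPolynomial.C (MvPolynomial.X j) * MvPolynomial.X i ^ (j.val + 1)) *
        Polynomial.X ^ (j.val + 1))
  have hs : (F.coeff n).IsSymmetric := by
    intro e
    rw [← AlgHom.coe_toRingHom, ← Polynomial.coeff_map, Polynomial.map_prod]
    congr 1
    refine (Fintype.prod_equiv e _ _ ?_)
    intro i
    simp [Polynomial.map_sum]
  obtain ⟨Q, hQ⟩ := (MvPolynomial.esymmAlgEquiv (Fin n) (MvPolynomial (Fin n) ℤ) (n := n) (by simp)).surjective ⟨_, hs⟩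
  have hQ' := congrArg Subtype.val hQ
  rw [MvPolynomial.esymmAlgEquiv_apply, MvPolynomial.esymmAlgHom_apply] at hQ'
  let φ : MvPolynomial (Fin n) ℤ →+* MvPolynomial (Fin n ⊕ Fin n) ℤ :=
    (MvPolynomial.aeval (fun j : Fin n =>
      MvPolynomial.rename Sum.inr (MvPolynomial.esymm (Fin n) ℤ (j + 1)))).toRingHom
  let Φ : MvPolynomial (Fin n) (MvPolynomial (Fin n) ℤ) →+* MvPolynomial (Fin n ⊕ Fin n) ℤ :=
    MvPolynomial.eval₂Hom φ (fun i => MvPolynomial.X (Sum.inl i))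
  let ι : MvPolynomial (Fin n) (MvPolynomial (Fin n) ℤ) →+* MvPolynomial (Fin n ⊕ Fin n) ℤ :=
    MvPolynomial.eval₂Hom (MvPolynomial.rename Sum.inr).toRingHom
      (fun i => MvPolynomial.X (Sum.inl i))
  have hF : Φ (F.coeff n) = prodSymm n := by
    rw [← Polynomial.coeff_map, prodSymm, Polynomial.map_prod]
    congr 1
    refine Finset.prod_congr rfl fun i _ => ?_
    rw [Finset.prod_one_add, Finset.sum_powerset, Finset.sum_range_succ']
    simp only [Polynomial.map_add, Polynomial.map_one, Polynomial.map_sum, Polynomial.map_mul,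
      Polynomial.map_pow, Polynomial.map_C, Polynomial.map_X, Finset.card_univ, Fintype.card_fin,
      Finset.powersetCard_zero, Finset.sum_singleton, Finset.prod_empty]
    rw [add_comm, Finset.sum_range]
    congr 1
    refine Finset.sum_congr rfl fun j _ => ?_
    have h1 : Φ (MvPolynomial.C (MvPolynomial.X j) * MvPolynomial.X i ^ (j.val + 1)) =
        ∑ t ∈ Finset.powersetCard (j.val + 1) (Finset.univ : Finset (Fin n)),
          ∏ k ∈ t, (MvPolynomial.X (Sum.inl i) * MvPolynomial.X (Sum.inr k)) := by
      have hC : Φ (MvPolynomial.C (MvPolynomial.X j)) =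
          MvPolynomial.rename Sum.inr (MvPolynomial.esymm (Fin n) ℤ (j + 1)) := by
        simp [Φ, φ]
      have hX : Φ (MvPolynomial.X i) = MvPolynomial.X (Sum.inl i) := by simp [Φ]
      rw [map_mul, map_pow, hC, hX]
      simp only [MvPolynomial.esymm, map_sum, map_prod, MvPolynomial.rename_X]
      rw [Finset.sum_mul]
      refine Finset.sum_congr rfl fun t ht => ?_
      rw [Finset.prod_mul_distrib, Finset.prod_const, (Finset.mem_powersetCard.1 ht).2, mul_comm]
    rw [h1, map_sum, Finset.sum_mul]
    refine Finset.sum_congr rfl fun t ht => ?_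
    rw [Finset.prod_mul_distrib (g := fun _ => Polynomial.X), Finset.prod_const,
      (Finset.mem_powersetCard.1 ht).2, map_prod Polynomial.C]
  refine ⟨ι Q, ?_⟩
  rw [IsMulPoly, ← hF, ← show _ = F.coeff n from hQ']
  change (((MvPolynomial.aeval _).toRingHom).comp ι) Q =
    (Φ.comp (MvPolynomial.aeval fun i : Fin n => MvPolynomial.esymm (Fin n) (MvPolynomial (Fin n) ℤ) (i + 1)).toRingHom) Q
  congr 1
  refine MvPolynomial.ringHom_ext' ?_ ?_
  · refine MvPolynomial.ringHom_ext' (RingHom.ext_int _ _) fun j => ?_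
    simp [ι, Φ, φ]
  · intro i
    simp [ι, Φ, MvPolynomial.esymm, map_sum, map_prod]

/-- The universal polynomial expressing `λ^n(x y)` through the `λ^i(x)` and the `λ^j(y)`;
the variable `Sum.inl i` stands for `λ^{i+1}(x)` and `Sum.inr j` for `λ^{j+1}(y)`. -/
noncomputable def mulPoly (n : ℕ) : MvPolynomial (Fin n ⊕ Fin n) ℤ :=
  (exists_isMulPoly n).choose

/-- The universal polynomial expressing `λ^n(λ^m(x))` through the `λ^i(x)`;
the variable `i` stands for `λ^{i+1}(x)`. -/
noncomputable def compPoly (n m : ℕ) : MvPolynomial (Fin (n * m)) ℤ :=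
  (exists_isCompPoly n m).choose

theorem mulPoly_spec (n : ℕ) : IsMulPoly n (mulPoly n) := (exists_isMulPoly n).choose_spec

theorem compPoly_spec (n m : ℕ) : IsCompPoly n m (compPoly n m) :=
  (exists_isCompPoly n m).choose_spec

end LambdaRing

/-! ### λ-rings -/

/-- A pre-λ-ring: operations `λ^n` with `λ^0 = 1`, `λ^1 = id`, such that
`x ↦ λ_t(x) = ∑ λ^n(x) t^n` turns sums into products. -/
class PreLambdaRing (R : Type u) [CommRing R] where
  lam : ℕ → R → R
  lam_zero : ∀ x, lam 0 x = 1
  lam_one : ∀ x, lam 1 x = x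
  lam_add : ∀ n x y, lam n (x + y) = ∑ p ∈ Finset.HasAntidiagonal.antidiagonal n, lam p.1 x * lam p.2 y

open PreLambdaRing (lam)

/-- A λ-ring: a pre-λ-ring `R` such that `λ_t : R → Λ(R) = 1 + t R[[t]]` is a homomorphism of
pre-λ-rings. The unit of `Λ(R)` is `1 + t`, and its multiplication and λ-operations are given by
the universal polynomials. -/
class LambdaRing (R : Type u) [CommRing R] extends PreLambdaRing R where
  lam_unit : ∀ n, 2 ≤ n → lam n 1 = 0
  lam_mul : ∀ n x y, lam n (x * y) =
    MvPolynomial.aeval (Sum.elim (fun i : Fin n => lam (i + 1) x)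
      (fun j : Fin n => lam (j + 1) y)) (LambdaRing.mulPoly n)
  lam_lam : ∀ n m x, lam n (lam m x) =
    MvPolynomial.aeval (fun i : Fin (n * m) => lam (i + 1) x) (LambdaRing.compPoly n m)

namespace LambdaRing

/-- `ε : R → ℤ` is an augmentation: a ring homomorphism with
`ε(λ^n(x)) = ε(x) (ε(x) - 1) ⋯ (ε(x) - n + 1) / n!`. -/
def IsAugmentation {R : Type u} [CommRing R] [PreLambdaRing R] (ε : R →+* ℤ) : Prop :=
  ∀ (n : ℕ) (x : R), ε (lam n x) = Ring.choose (ε x) n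

/-- `γ^n(x)`, the coefficient of `t ^ n` in `γ_t(x) = λ_{t/(1-t)}(x) = ∑_i λ^i(x) (t/(1-t))^i`.
Only the terms with `i ≤ n` contribute to it; `PowerSeries.mk 1` is `1/(1-t)`. -/
noncomputable def gam {R : Type u} [CommRing R] [PreLambdaRing R] (n : ℕ) (x : R) : R :=
  ∑ i ∈ Finset.range (n + 1),
    lam i x * PowerSeries.coeff n (((PowerSeries.X : PowerSeries R) * PowerSeries.mk 1) ^ i)

/-- The γ-filtration: `Fil^q` is the subgroup generated by the products
`γ^{i_1}(x_1) ⋯ γ^{i_p}(x_p)` with `p ≥ 0`, `ε(x_j) = 0` and `i_1 + ⋯ + i_p ≥ q`. -/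
def gammaFil {R : Type u} [CommRing R] [PreLambdaRing R] (ε : R →+* ℤ) (q : ℕ) : AddSubgroup R :=
  AddSubgroup.closure {y | ∃ l : List (ℕ × R), (∀ p ∈ l, ε p.2 = 0) ∧
    q ≤ (l.map fun p => p.1).sum ∧ y = (l.map fun p => gam p.1 p.2).prod}

/-- `λ_{-1}(N) = ∑_{i ≤ d} (-1)^i λ^i(N)`, for `N` with `λ^k(N) = 0` for all `k > d`. -/
def lamNegOne {R : Type u} [CommRing R] [PreLambdaRing R] (d : ℕ) (N : R) : R :=
  ∑ i ∈ Finset.range (d + 1), (-1) ^ i * lam i N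

/-- The value at `(N, x)` of a polynomial in `λ^1(N), …, λ^d(N)` and `λ^1(x), λ^2(x), …`. -/
noncomputable def evalAt {R : Type u} [CommRing R] [PreLambdaRing R] (d : ℕ)
    (Q : MvPolynomial (Fin d ⊕ ℕ) ℤ) (N x : R) : R :=
  MvPolynomial.aeval (Sum.elim (fun i : Fin d => lam (i + 1) N) (fun j : ℕ => lam (j + 1) x)) Q

/-- `Q` is a universal formula for `λ^n(N, x)`: one has
`λ^n(x λ_{-1}(N)) = Q(N, x) λ_{-1}(N)` in every λ-ring, for all `N` with `λ^k(N) = 0` for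
`k > d` and all `x`. -/
def IsTwistedPoly (d n : ℕ) (Q : MvPolynomial (Fin d ⊕ ℕ) ℤ) : Prop :=
  ∀ (A : Type u) [CommRing A] [LambdaRing A] (N x : A), (∀ k, d < k → lam k N = 0) →
    lam n (x * lamNegOne d N) = evalAt d Q N x * lamNegOne d N

/-- The universal polynomial defining `λ^n(N, x)`. -/
noncomputable def twistedPoly (d n : ℕ) : MvPolynomial (Fin d ⊕ ℕ) ℤ :=
  Classical.epsilon (IsTwistedPoly.{u} d n)

/-- The twisted operation `λ^n(N, x)`, for `n ≥ 1` and `N` with `λ^k(N) = 0` for `k > d`. -/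
noncomputable def twistedLam {R : Type u} [CommRing R] [PreLambdaRing R] (d n : ℕ) (N x : R) : R :=
  evalAt d (twistedPoly.{u} d n) N x

end LambdaRing

/-!
The theorem is deduced from a calculation in polynomial rings, by way of two facts.

*Universality* (`IsUniversal`, `IsUniversal.lam`). Whatever is built from `N`, with `λ^k(N) = 0` for
`k > d`, and from a family of elements `x_j` by ring operations and the `λ^n` is given, in all
λ-rings at once, by one integral polynomial in the `γ^i(N - d)`, `1 ≤ i ≤ d`, and the `γ^i(x_j)`.
Moreover `λ_{-1}(N) = (-1)^d γ^d(N - d)`.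

*A generic point* (`genN`, `genX`). The polynomial ring in `y_1, …, y_d` and the `z_{j,i}` is a
λ-ring in which the `1 + y_i` and `1 + z_{j,i}` are line elements (`instMvPolynomial`). It comes
from the Adams operations `1 + y ↦ (1 + y)^k`; the identities of a λ-ring are checked over an
algebraically closed field, where truncations of `λ_t(f)` split into linear factors (`ofAdams`).
For `N = ∑ (1 + y_i)` and `x_j = ∑_i z_{j,i}` the `γ^i(N - d)` and `γ^i(x_j)` are the elementary
symmetric functions of the blocks of variables. These can be given arbitrary values in an
algebraically closed field (`exists_coeff_linProd`), hence they are algebraically independent, and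
a polynomial identity at generic points holds in every λ-ring.

For the existence of `λ^n(N, x)`, one has `λ^n(x λ_{-1}(N)) = F`, a polynomial in the `γ^i(N - d)`
and `γ^i(x)`; it must be divisible by the variable `γ^d(N - d)`, that is, vanish when
`y_1 ⋯ y_d = 0`. This holds since `n λ^n(f)` is a combination of the `λ^{n-i}(f) ψ^i(f)`, `i ≥ 1`,
and `y_1 ⋯ y_d` divides its images under the `ψ^i`. Uniqueness holds since the generic ring is a
domain.

For the congruence, `Fil^q` is the set of values of the polynomials in the `γ^i(y)`, `ε(y) = 0`,
all of whose monomials have weight at least `q`, where `γ^i` has weight `i`. So it suffices to bound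
below the weights of the universal polynomial giving `λ^n(N, x) + (-1)^n n^{q+d-1} x`, and
at the generic point weights become degrees (`weightHom_intEval`). There `ψ^k` multiplies leading
forms of degree `w` by `k^w`, so that `λ^n` multiplies them by `(-1)^{n-1} n^{w-1}` if `w ≥ 1`
(`lam_add_mem_varIdeal_pow`). Applying this with `w = q + d` to `x λ_{-1}(N)`, and dividing by
`λ_{-1}(N) = ± y_1 ⋯ y_d`, which has degree `d`, gives the claim (`X_pow_dvd_gen`).
-/

/-! ### Power series and their power sums -/

namespace PowerSeries

variable {A B : Type*} [CommRing A] [CommRing B]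

/-- `f` is the series `∑ e_n t ^ n` of elementary symmetric functions whose power sums are
`p 1, p 2, …`: its constant term is `1` and its logarithmic derivative is
`∑ (-1) ^ i p (i + 1) t ^ i`. The value `p 0` plays no role. -/
def HasPowerSums (f : A⟦X⟧) (p : ℕ → A) : Prop :=
  constantCoeff f = 1 ∧ derivative A f = f * mk fun i => (-1) ^ i * p (i + 1)

namespace HasPowerSums

theorem one : HasPowerSums (1 : A⟦X⟧) 0 := by
  refine ⟨by simp, ?_⟩
  rw [show (mk fun i => (-1) ^ i * (0 : ℕ → A) (i + 1)) = 0 by ext; simp]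
  simp

theorem mul {f g : A⟦X⟧} {p q : ℕ → A} (hf : HasPowerSums f p) (hg : HasPowerSums g q) :
    HasPowerSums (f * g) (p + q) := by
  refine ⟨by simp [hf.1, hg.1], ?_⟩
  rw [show (mk fun i => (-1) ^ i * (p + q) (i + 1)) =
    (mk fun i => (-1) ^ i * p (i + 1)) + mk fun i => (-1) ^ i * q (i + 1) by
      ext; simp [mul_add]]
  rw [Derivation.leibniz, hf.2, hg.2, smul_eq_mul, smul_eq_mul]
  ring

theorem of_mul_eq_one {f g : A⟦X⟧} {p : ℕ → A} (hf : HasPowerSums f p) (h : f * g = 1) :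
    HasPowerSums g (-p) := by
  have h0 : constantCoeff g = 1 := by
    have := congrArg constantCoeff h
    simpa [hf.1] using this
  refine ⟨h0, ?_⟩
  rw [show (mk fun i => (-1) ^ i * (-p) (i + 1)) = -(mk fun i => (-1) ^ i * p (i + 1)) by
      ext; simp]
  have h1 := congrArg (derivative A) h
  rw [Derivation.leibniz, hf.2, derivative_one, smul_eq_mul, smul_eq_mul] at h1
  linear_combination g * h1 - (derivative A g +
    g * (mk fun i => (-1) ^ i * p (i + 1))) * h

theorem linear (l : A) : HasPowerSums (1 + C l * X) fun k => l ^ k := by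
  refine ⟨by simp, ?_⟩
  ext n
  rcases n with _ | n
  · simp [mul_comm, add_mul]
  · simp [add_mul, mul_assoc, coeff_succ_X_mul]
    ring

theorem prod {κ : Type*} (s : Finset κ) {f : κ → A⟦X⟧} {p : κ → ℕ → A}
    (h : ∀ i ∈ s, HasPowerSums (f i) (p i)) :
    HasPowerSums (∏ i ∈ s, f i) (∑ i ∈ s, p i) := by
  classical
  induction s using Finset.induction_on with
  | empty => simpa using one
  | insert a s ha ih =>
    rw [Finset.prod_insert ha, Finset.sum_insert ha]
    exact (h a (by simp)).mul (ih fun i hi => h i (by simp [hi]))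

theorem map (φ : A →+* B) {f : A⟦X⟧} {p : ℕ → A} (hf : HasPowerSums f p) :
    HasPowerSums (PowerSeries.map φ f) fun k => φ (p k) := by
  refine ⟨?_, ?_⟩
  · rw [← coeff_zero_eq_constantCoeff_apply, coeff_map, coeff_zero_eq_constantCoeff_apply, hf.1,
      map_one]
  · have := congrArg (PowerSeries.map φ) hf.2
    rw [map_mul] at this
    convert this using 1
    · ext n; simp [coeff_derivative]
    · congr 1; ext n; simp

theorem coeff_succ {f : A⟦X⟧} {p : ℕ → A} (hf : HasPowerSums f p) (n : ℕ) :
    (n + 1 : A) * coeff (n + 1) f =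
      ∑ i ∈ Finset.range (n + 1), coeff i f * ((-1) ^ (n - i) * p (n - i + 1)) := by
  have := congrArg (coeff n) hf.2
  rw [coeff_derivative, coeff_mul, Finset.Nat.sum_antidiagonal_eq_sum_range_succ_mk] at this
  rw [mul_comm, this]
  simp

theorem coeff_one {f : A⟦X⟧} {p : ℕ → A} (hf : HasPowerSums f p) : coeff 1 f = p 1 := by
  simpa [hf.1] using hf.coeff_succ 0

/-- Over a torsion-free ring, the power sums determine the elementary symmetric functions. -/
theorem coeff_eq [IsDomain A] [CharZero A] {f g : A⟦X⟧} {p q : ℕ → A}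
    (hf : HasPowerSums f p) (hg : HasPowerSums g q) {n : ℕ}
    (h : ∀ k, k + 1 ≤ n → p (k + 1) = q (k + 1)) : ∀ k ≤ n, coeff k f = coeff k g := by
  intro k
  induction k using Nat.strong_induction_on with
  | _ k ih =>
    intro hk
    rcases k with _ | k
    · simp [hf.1, hg.1]
    · have h1 : (k + 1 : A) ≠ 0 := by exact_mod_cast k.succ_ne_zero
      refine mul_left_cancel₀ h1 ?_
      rw [hf.coeff_succ, hg.coeff_succ]
      refine Finset.sum_congr rfl fun i hi => ?_
      have hi' := Finset.mem_range.1 hi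
      rw [ih i (by omega) (by omega), h _ (by omega)]

theorem ext [IsDomain A] [CharZero A] {f g : A⟦X⟧} {p : ℕ → A}
    (hf : HasPowerSums f p) (hg : HasPowerSums g p) : f = g := by
  ext n
  exact hf.coeff_eq hg (fun _ _ => rfl) n le_rfl

/-- Over any ring, the elementary symmetric functions determine the power sums. -/
theorem powerSum_eq {f g : A⟦X⟧} {p q : ℕ → A}
    (hf : HasPowerSums f p) (hg : HasPowerSums g q) {n : ℕ}
    (h : ∀ k ≤ n, coeff k f = coeff k g) : ∀ k, k + 1 ≤ n → p (k + 1) = q (k + 1) := by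
  intro k
  induction k using Nat.strong_induction_on with
  | _ k ih =>
    intro hk
    have h1 := hf.coeff_succ k
    have h2 := hg.coeff_succ k
    rw [Finset.sum_range_succ'] at h1 h2
    rw [h (k + 1) hk, h2] at h1
    have h3 : ∑ i ∈ Finset.range k,
        coeff (i + 1) g * ((-1) ^ (k - (i + 1)) * q (k - (i + 1) + 1)) =
        ∑ i ∈ Finset.range k,
        coeff (i + 1) f * ((-1) ^ (k - (i + 1)) * p (k - (i + 1) + 1)) := by
      refine Finset.sum_congr rfl fun i hi => ?_
      have hi' := Finset.mem_range.1 hi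
      rw [h (i + 1) (by omega), ih (k - (i + 1)) (by omega) (by omega)]
    rw [h3] at h1
    simp only [coeff_zero_eq_constantCoeff_apply, hf.1, hg.1, one_mul, Nat.sub_zero] at h1
    have h4 := add_left_cancel h1
    have h5 := congrArg (fun z => (-1) ^ k * z) h4
    simpa [← mul_assoc, ← mul_pow] using h5.symm

end HasPowerSums

/-- The series `∏ i, (1 + v i * t)`, whose coefficients are the elementary symmetric functions
of the family `v`. -/
noncomputable def linProd {κ : Type*} [Fintype κ] (v : κ → A) : A⟦X⟧ := ∏ i, (1 + C (v i) * X)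

section linProd
variable {κ : Type*} [Fintype κ]

theorem hasPowerSums_linProd (v : κ → A) : HasPowerSums (linProd v) fun k => ∑ i, v i ^ k := by
  have := HasPowerSums.prod Finset.univ (f := fun i => 1 + C (v i) * X)
    (p := fun i k => v i ^ k) fun i _ => HasPowerSums.linear (v i)
  have e : (fun k => ∑ i, v i ^ k) = ∑ i, fun k => v i ^ k := by
    ext k
    rw [Finset.sum_apply]
  rwa [e]

theorem coeff_linProd (v : κ → A) (k : ℕ) :
    coeff k (linProd v) = MvPolynomial.aeval v (MvPolynomial.esymm κ ℤ k) := by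
  classical
  rw [linProd, Finset.prod_one_add, map_sum, MvPolynomial.aeval_esymm_eq_multiset_esymm,
    Finset.esymm_map_val, Finset.powersetCard_eq_filter, Finset.sum_filter]
  refine Finset.sum_congr rfl fun t _ => ?_
  rw [Finset.prod_mul_distrib, Finset.prod_const, ← map_prod, coeff_C_mul, coeff_X_pow]
  simp [eq_comm]

theorem constantCoeff_linProd (v : κ → A) : constantCoeff (linProd v) = 1 :=
  (hasPowerSums_linProd v).1

theorem coeff_linProd_eq_zero (v : κ → A) {k : ℕ} (hk : Fintype.card κ < k) :
    coeff k (linProd v) = 0 := by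
  rw [coeff_linProd, MvPolynomial.esymm, Finset.powersetCard_eq_empty.2 (by simpa using hk)]
  simp

theorem coeff_card_linProd (v : κ → A) : coeff (Fintype.card κ) (linProd v) = ∏ i, v i := by
  rw [coeff_linProd, MvPolynomial.esymm, ← Finset.card_univ, Finset.powersetCard_self]
  simp

theorem map_linProd (φ : A →+* B) (v : κ → A) : map φ (linProd v) = linProd fun i => φ (v i) := by
  simp [linProd, map_prod]

theorem coeff_linProd_mul (c : A) (v : κ → A) (k : ℕ) :
    coeff k (linProd fun i => c * v i) = c ^ k * coeff k (linProd v) := by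
  have hC : ∀ b : A, rescale c (C b) = C b := fun b => by
    ext n
    rcases n with _ | n <;> simp [coeff_C]
  rw [← coeff_rescale]
  congr 1
  simp only [linProd, map_prod, map_add, map_one, map_mul, rescale_X, hC]
  refine Finset.prod_congr rfl fun i _ => ?_
  ring

/-- The coefficient of `t ^ k` in `∏ i, (1 + v i * t)` is homogeneous of degree `k` in `v`. -/
theorem map_coeff_linProd_of_eq_mul {φ ψ : A →+* B} {c : B} {v : κ → A}
    (h : ∀ i, φ (v i) = c * ψ (v i)) (k : ℕ) :
    φ (coeff k (linProd v)) = c ^ k * ψ (coeff k (linProd v)) := by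
  rw [← coeff_map, ← coeff_map, map_linProd, map_linProd, ← coeff_linProd_mul]
  simp only [h]

end linProd

theorem coeff_polynomial_prod {κ : Type*} (s : Finset κ) (w : κ → A) (k : ℕ) :
    (∏ i ∈ s, (1 + Polynomial.C (w i) * Polynomial.X)).coeff k =
      coeff k (∏ i ∈ s, (1 + C (w i) * X)) := by
  rw [← Polynomial.coeff_coe]
  congr 1
  rw [← Polynomial.coeToPowerSeries.ringHom_apply, map_prod]
  simp

/-- Over an algebraically closed field the elementary symmetric functions of `M` elements take
arbitrary values. -/
theorem exists_coeff_linProd {K : Type*} [Field K] [IsAlgClosed K] (M : ℕ) (a : Fin M → K) :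
    ∃ x : Fin M → K, ∀ i : Fin M, coeff (i + 1) (linProd x) = a i := by
  let r : Polynomial K := ∑ i : Fin M, Polynomial.C (a i) * Polynomial.X ^ (M - 1 - i.val)
  let p : Polynomial K := Polynomial.X ^ M + r
  rcases Nat.eq_zero_or_pos M with rfl | hM
  · exact ⟨Fin.elim0, fun i => i.elim0⟩
  have hr : r.degree < M := by
    refine lt_of_le_of_lt (Polynomial.degree_sum_le _ _) ?_
    refine (Finset.sup_lt_iff (by exact_mod_cast WithBot.bot_lt_coe M)).2 fun i _ => ?_
    refine lt_of_le_of_lt (Polynomial.degree_C_mul_X_pow_le _ _) ?_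
    exact_mod_cast (show M - 1 - i.val < M by omega)
  have hp : p.Monic := Polynomial.monic_X_pow_add hr
  have hd : p.natDegree = M := by
    refine Polynomial.natDegree_eq_of_degree_eq_some ?_
    rw [Polynomial.degree_add_eq_left_of_degree_lt] <;> simp [hr]
  have hc : p.roots.card = p.natDegree := by
    rw [← Polynomial.splits_iff_card_roots]
    exact IsAlgClosed.splits p
  obtain ⟨l, hl⟩ := Quot.exists_rep (p.roots.map fun z => -z)
  have hlen : l.length = M := by
    have := congrArg Multiset.card hl
    simpa [hc, hd] using this
  subst hlen
  refine ⟨fun i => l.get i, fun i => ?_⟩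
  rw [coeff_linProd, MvPolynomial.aeval_esymm_eq_multiset_esymm, Fin.univ_val_map, List.ofFn_get]
  change Multiset.esymm (Quot.mk _ l) _ = _
  rw [hl, Multiset.esymm_neg]
  have h1 := Polynomial.coeff_eq_esymm_roots_of_card hc (k := l.length - 1 - i.val) (by omega)
  rw [hp.leadingCoeff, hd, one_mul, show l.length - (l.length - 1 - i.val) = i.val + 1 by omega]
    at h1
  rw [← h1]
  simp only [p, r, Polynomial.coeff_add, Polynomial.coeff_X_pow, Polynomial.finsetSum_coeff,
    Polynomial.coeff_C_mul]
  rw [if_neg (by omega), zero_add, Finset.sum_eq_single i]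
  · simp
  · intro j _ hj
    rw [if_neg, mul_zero]
    intro h
    exact hj (Fin.ext (by omega))
  · simp

end PowerSeries

/-! ### λ-rings from Adams operations -/

namespace LambdaRing

open PowerSeries (HasPowerSums linProd)

/-- The value of an integral polynomial at a family of elements of a commutative ring. -/
noncomputable def intEval {σ B : Type*} [CommRing B] (v : σ → B) : MvPolynomial σ ℤ →+* B :=
  MvPolynomial.eval₂Hom (Int.castRingHom B) v

@[simp] theorem intEval_X {σ B : Type*} [CommRing B] (v : σ → B) (i : σ) :
    intEval v (MvPolynomial.X i) = v i := by
  simp [intEval]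

theorem aeval_eq_intEval {σ B : Type*} [CommRing B] (v : σ → B) (p : MvPolynomial σ ℤ) :
    MvPolynomial.aeval v p = intEval v p := rfl

theorem map_intEval {σ B B' : Type*} [CommRing B] [CommRing B'] (φ : B →+* B') (g : σ → B)
    (p : MvPolynomial σ ℤ) :
    φ (intEval g p) = intEval (fun i => φ (g i)) p := by
  induction p using MvPolynomial.induction_on with
  | C a => simp
  | add p q hp hq => simp [hp, hq]
  | mul_X p i hp => simp [hp]

theorem aeval_mulPoly {B : Type*} [CommRing B] {n : ℕ} (v w : Fin n → B) :
    MvPolynomial.aeval (Sum.elim (fun i : Fin n => PowerSeries.coeff (i + 1) (linProd v))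
      (fun j : Fin n => PowerSeries.coeff (j + 1) (linProd w))) (mulPoly n) =
    PowerSeries.coeff n (linProd fun p : Fin n × Fin n => v p.1 * w p.2) := by
  let φ : MvPolynomial (Fin n ⊕ Fin n) ℤ →ₐ[ℤ] B := MvPolynomial.aeval (Sum.elim v w)
  have h := congrArg φ (mulPoly_spec n)
  rw [← AlgHom.comp_apply, MvPolynomial.comp_aeval] at h
  have e : (fun i : Fin n ⊕ Fin n => φ (Sum.elim
      (fun i : Fin n => MvPolynomial.rename Sum.inl (MvPolynomial.esymm (Fin n) ℤ (i + 1)))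
      (fun j : Fin n => MvPolynomial.rename Sum.inr (MvPolynomial.esymm (Fin n) ℤ (j + 1))) i)) =
      Sum.elim (fun i : Fin n => PowerSeries.coeff (i + 1) (linProd v))
      (fun j : Fin n => PowerSeries.coeff (j + 1) (linProd w)) := by
    funext i
    rcases i with i | i <;>
      simp [φ, PowerSeries.coeff_linProd, MvPolynomial.aeval_rename, Function.comp_def]
  rw [e] at h
  rw [h, prodSymm, ← AlgHom.coe_toRingHom, ← Polynomial.coeff_map, Polynomial.map_prod, linProd,
    ← PowerSeries.coeff_polynomial_prod, Fintype.prod_prod_type]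
  congr 1
  refine Finset.prod_congr rfl fun i _ => ?_
  rw [Polynomial.map_prod]
  refine Finset.prod_congr rfl fun j _ => ?_
  simp [φ]

theorem aeval_compPoly {B : Type*} [CommRing B] {n m : ℕ} (v : Fin (n * m) → B) :
    MvPolynomial.aeval (fun i : Fin (n * m) => PowerSeries.coeff (i + 1) (linProd v))
      (compPoly n m) =
    PowerSeries.coeff n (linProd fun s : Finset.powersetCard m (Finset.univ : Finset (Fin (n * m)))
      => ∏ i ∈ s.1, v i) := by
  let φ : MvPolynomial (Fin (n * m)) ℤ →ₐ[ℤ] B := MvPolynomial.aeval v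
  have h := congrArg φ (compPoly_spec n m)
  rw [← AlgHom.comp_apply, MvPolynomial.comp_aeval] at h
  have e : (fun i : Fin (n * m) => φ (MvPolynomial.esymm (Fin (n * m)) ℤ (i + 1))) =
      fun i : Fin (n * m) => PowerSeries.coeff (i + 1) (linProd v) := by
    funext i
    simp [φ, PowerSeries.coeff_linProd]
  rw [e] at h
  rw [h, compSymm, ← AlgHom.coe_toRingHom, ← Polynomial.coeff_map, Polynomial.map_prod, linProd,
    ← PowerSeries.coeff_polynomial_prod, Finset.univ_eq_attach,
    Finset.prod_attach _ (fun s => 1 + Polynomial.C (∏ i ∈ s, v i) * Polynomial.X)]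
  congr 1
  refine Finset.prod_congr rfl fun i _ => ?_
  simp [φ, Polynomial.map_prod]

/-- Elements `v` of an algebraically closed field whose first `M` elementary symmetric functions
are the given ones. Their first `M` power sums are then the given ones as well. -/
theorem exists_splitting {K : Type*} [Field K] [IsAlgClosed K] (M : ℕ) {f : PowerSeries K}
    {p : ℕ → K} (hf : HasPowerSums f p) : ∃ v : Fin M → K,
      (∀ i : Fin M, PowerSeries.coeff (i + 1) (linProd v) = PowerSeries.coeff (i + 1) f) ∧
      ∀ k, k + 1 ≤ M → ∑ i, v i ^ (k + 1) = p (k + 1) := by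
  obtain ⟨v, hv⟩ := PowerSeries.exists_coeff_linProd M fun i => PowerSeries.coeff (i + 1) f
  refine ⟨v, hv, (PowerSeries.hasPowerSums_linProd v).powerSum_eq hf ?_⟩
  intro k hk
  rcases k with _ | k
  · simp [PowerSeries.constantCoeff_linProd, hf.1]
  · exact hv ⟨k, hk⟩

section Adams

theorem exists_injective_isAlgClosed (A : Type u) [CommRing A] [IsDomain A] [CharZero A] :
    ∃ (K : Type u) (_ : Field K) (_ : IsAlgClosed K) (_ : CharZero K) (φ : A →+* K),
      Function.Injective φ := by
  let φ := (algebraMap (FractionRing A) (AlgebraicClosure (FractionRing A))).comp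
    (algebraMap A (FractionRing A))
  have hφ : Function.Injective φ :=
    (algebraMap (FractionRing A) (AlgebraicClosure (FractionRing A))).injective.comp
      (IsFractionRing.injective A (FractionRing A))
  refine ⟨_, inferInstance, inferInstance, ⟨fun a b h => ?_⟩, φ, hφ⟩
  exact Nat.cast_injective (R := A) (hφ (by simpa using h))

variable {A : Type u} [CommRing A] [IsDomain A] [CharZero A]

/-- A torsion-free domain with commuting Adams operations `ψ k` is a λ-ring as soon as the series
`λ_t(x)` with power sums `ψ k x` exist. The identities of a λ-ring are checked over an
algebraically closed field, where the truncations of `λ_t(x)` split into linear factors. -/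
@[reducible] noncomputable def ofAdams (ψ : ℕ → A →+* A) (h1 : ∀ x, ψ 1 x = x)
    (hcomp : ∀ k l x, ψ k (ψ l x) = ψ (k * l) x)
    (L : A → PowerSeries A) (hL : ∀ x, HasPowerSums (L x) fun k => ψ k x) : LambdaRing A where
  lam n x := PowerSeries.coeff n (L x)
  lam_zero x := by simp [(hL x).1]
  lam_one x := by rw [(hL x).coeff_one, h1]
  lam_add n x y := by
    rw [← PowerSeries.coeff_mul]
    congr 1
    refine (hL (x + y)).ext ?_
    convert (hL x).mul (hL y) using 1
    ext k; simp
  lam_unit n hn := by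
    have h := (hL 1).ext (g := 1 + PowerSeries.C 1 * PowerSeries.X) (by
      convert HasPowerSums.linear (1 : A) using 1
      ext k; simp)
    rw [h]
    simp [PowerSeries.coeff_one, PowerSeries.coeff_X, show n ≠ 0 by omega, show n ≠ 1 by omega]
  lam_mul n x y := by
    obtain ⟨K, _, _, _, φ, hφ⟩ := exists_injective_isAlgClosed A
    obtain ⟨v, hv, hv'⟩ := exists_splitting n ((hL x).map φ)
    obtain ⟨w, hw, hw'⟩ := exists_splitting n ((hL y).map φ)
    have key := ((hL (x * y)).map φ).coeff_eq
      (PowerSeries.hasPowerSums_linProd fun p : Fin n × Fin n => v p.1 * w p.2) (n := n) (by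
        intro k hk
        simp only [mul_pow, map_mul, Fintype.sum_prod_type, ← Finset.mul_sum, ← Finset.sum_mul]
        rw [hv' k hk, hw' k hk]) n le_rfl
    apply hφ
    rw [PowerSeries.coeff_map] at key
    rw [key, ← aeval_mulPoly, aeval_eq_intEval, aeval_eq_intEval, map_intEval]
    congr 2
    funext i
    rcases i with i | i
    · exact hv i
    · exact hw i
  lam_lam n m x := by
    obtain ⟨K, _, _, _, φ, hφ⟩ := exists_injective_isAlgClosed A
    obtain ⟨v, hv, hv'⟩ := exists_splitting (n * m) ((hL x).map φ)
    have key := ((hL (PowerSeries.coeff m (L x))).map φ).coeff_eq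
      (PowerSeries.hasPowerSums_linProd fun s :
        Finset.powersetCard m (Finset.univ : Finset (Fin (n * m))) => ∏ i ∈ s.1, v i) (n := n) (by
        intro k hk
        have h := (PowerSeries.hasPowerSums_linProd fun i => v i ^ (k + 1)).coeff_eq
          (((hL x).map (ψ (k + 1))).map φ) (n := m) (by
            intro j hj
            simp only [← pow_mul, hcomp]
            obtain ⟨r, hr⟩ : ∃ r, (k + 1) * (j + 1) = r + 1 := ⟨k * j + k + j, by ring⟩
            rw [hr, hv' r (by rw [← hr]; exact Nat.mul_le_mul hk hj)]) m le_rfl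
        rw [PowerSeries.coeff_map, PowerSeries.coeff_map] at h
        rw [← h, PowerSeries.coeff_linProd, MvPolynomial.esymm, Finset.univ_eq_attach,
          Finset.sum_attach _ (fun s => (∏ i ∈ s, v i) ^ (k + 1))]
        simp [Finset.prod_pow]) n le_rfl
    apply hφ
    rw [PowerSeries.coeff_map] at key
    rw [key, ← aeval_compPoly, aeval_eq_intEval, aeval_eq_intEval, map_intEval]
    congr 2
    funext i
    exact hv i

end Adams

end LambdaRing

/-! ### The series `λ_t` and `γ_t` -/

namespace LambdaRing

open PowerSeries (HasPowerSums linProd)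

theorem hasSubst_X_mul_mk_one {A : Type*} [CommRing A] :
    PowerSeries.HasSubst ((PowerSeries.X : PowerSeries A) * PowerSeries.mk 1) :=
  PowerSeries.HasSubst.of_constantCoeff_zero' (by simp)

theorem coeff_pow_X_mul_mk_one {A : Type*} [CommRing A] (n i : ℕ) :
    PowerSeries.coeff (n + 1) (((PowerSeries.X : PowerSeries A) * PowerSeries.mk 1) ^ i) =
      if i = 0 then 0 else (n.choose (i - 1) : A) := by
  rcases i with _ | i
  · simp [PowerSeries.coeff_one]
  · rw [mul_pow, PowerSeries.coeff_X_pow_mul', PowerSeries.mk_one_pow_eq_mk_choose_add]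
    simp only [Nat.add_le_add_iff_right, Nat.add_sub_add_right, PowerSeries.coeff_mk]
    by_cases h : i ≤ n
    · rw [if_pos h, if_neg (by omega), Nat.add_sub_cancel' h]
      simp
    · rw [if_neg h, if_neg (by omega)]
      simp [Nat.choose_eq_zero_of_lt (not_le.1 h)]

section Pre

variable {A : Type u} [CommRing A] [PreLambdaRing A]

/-- The series `λ_t(x) = ∑ λ^n(x) t ^ n`. -/
noncomputable def lamSeries (x : A) : PowerSeries A := PowerSeries.mk fun n => lam n x

@[simp] theorem coeff_lamSeries (n : ℕ) (x : A) :
    PowerSeries.coeff n (lamSeries x) = lam n x := PowerSeries.coeff_mk _ _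

theorem lamSeries_add (x y : A) : lamSeries (x + y) = lamSeries x * lamSeries y := by
  ext n
  simp [PowerSeries.coeff_mul, PreLambdaRing.lam_add]

theorem lamSeries_zero : lamSeries (0 : A) = 1 := by
  have h0 : IsUnit (lamSeries (0 : A)) := by
    rw [PowerSeries.isUnit_iff_constantCoeff, ← PowerSeries.coeff_zero_eq_constantCoeff_apply,
      coeff_lamSeries, PreLambdaRing.lam_zero]
    exact isUnit_one
  have h : lamSeries (0 : A) * lamSeries (0 : A) = lamSeries (0 : A) * 1 := by
    rw [← lamSeries_add, add_zero, mul_one]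
  exact h0.mul_left_cancel h

theorem lamSeries_mul_neg (x : A) : lamSeries x * lamSeries (-x) = 1 := by
  rw [← lamSeries_add, add_neg_cancel, lamSeries_zero]

theorem lamSeries_sum {κ : Type*} (s : Finset κ) (f : κ → A) :
    lamSeries (∑ i ∈ s, f i) = ∏ i ∈ s, lamSeries (f i) := by
  classical
  induction s using Finset.induction_on with
  | empty => simp [lamSeries_zero]
  | insert a s ha ih => rw [Finset.sum_insert ha, Finset.prod_insert ha, lamSeries_add, ih]

theorem lam_zero_of_pos {n : ℕ} (hn : n ≠ 0) : lam n (0 : A) = 0 := by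
  rw [← coeff_lamSeries, lamSeries_zero, PowerSeries.coeff_one, if_neg hn]

/-- The series `γ_t(x) = ∑ γ^n(x) t ^ n`. -/
noncomputable def gamSeries (x : A) : PowerSeries A := PowerSeries.mk fun n => gam n x

@[simp] theorem coeff_gamSeries (n : ℕ) (x : A) :
    PowerSeries.coeff n (gamSeries x) = gam n x := PowerSeries.coeff_mk _ _

theorem gamSeries_eq_subst (x : A) :
    gamSeries x = (lamSeries x).subst ((PowerSeries.X : PowerSeries A) * PowerSeries.mk 1) := by
  ext n
  rw [coeff_gamSeries, PowerSeries.coeff_subst' hasSubst_X_mul_mk_one,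
    finsum_eq_sum_of_support_subset (s := Finset.range (n + 1)), gam]
  · simp
  · intro i hi
    simp only [Finset.coe_range, Set.mem_Iio]
    by_contra h
    refine hi ?_
    simp only [mul_pow]
    rw [PowerSeries.coeff_X_pow_mul', if_neg (by omega), smul_zero]

theorem gamSeries_add (x y : A) : gamSeries (x + y) = gamSeries x * gamSeries y := by
  rw [gamSeries_eq_subst, lamSeries_add, PowerSeries.subst_mul hasSubst_X_mul_mk_one,
    ← gamSeries_eq_subst, ← gamSeries_eq_subst]

theorem gamSeries_zero : gamSeries (0 : A) = 1 := by
  rw [gamSeries_eq_subst, lamSeries_zero, ← PowerSeries.coe_substAlgHom hasSubst_X_mul_mk_one,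
    map_one]

theorem gamSeries_sum {κ : Type*} (s : Finset κ) (f : κ → A) :
    gamSeries (∑ i ∈ s, f i) = ∏ i ∈ s, gamSeries (f i) := by
  classical
  induction s using Finset.induction_on with
  | empty => simp [gamSeries_zero]
  | insert a s ha ih => rw [Finset.sum_insert ha, Finset.prod_insert ha, gamSeries_add, ih]

theorem gam_zero (x : A) : gam 0 x = 1 := by simp [gam, PreLambdaRing.lam_zero]

theorem gam_succ (n : ℕ) (x : A) :
    gam (n + 1) x = ∑ i ∈ Finset.range (n + 1), (n.choose i : A) * lam (i + 1) x := by
  rw [gam, Finset.sum_range_succ']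
  simp only [coeff_pow_X_mul_mk_one]
  simp [mul_comm]

end Pre

section LambdaRing

variable {A : Type u} [CommRing A] [LambdaRing A]

theorem lamSeries_one : lamSeries (1 : A) = 1 + PowerSeries.X := by
  ext n
  rcases n with _ | _ | n
  · simp [PreLambdaRing.lam_zero]
  · simp [PreLambdaRing.lam_one, PowerSeries.coeff_one]
  · simp [LambdaRing.lam_unit, PowerSeries.coeff_one, PowerSeries.coeff_X]

theorem lamSeries_natCast (k : ℕ) : lamSeries (k : A) = (1 + PowerSeries.X) ^ k := by
  induction k with
  | zero => simp [lamSeries_zero]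
  | succ k ih => rw [Nat.cast_succ, lamSeries_add, ih, lamSeries_one, pow_succ]

theorem lam_natCast (n k : ℕ) : lam n (k : A) = (k.choose n : A) := by
  rw [← coeff_lamSeries, lamSeries_natCast, ← Polynomial.coeff_one_add_X_pow,
    ← Polynomial.coeff_coe]
  simp

theorem lamSeries_neg_one : lamSeries (-1 : A) = PowerSeries.mk fun n => (-1) ^ n := by
  have h1 := lamSeries_mul_neg (1 : A)
  have h2 : (1 + PowerSeries.X) * (PowerSeries.mk fun n => (-1 : A) ^ n) = 1 := by
    ext n
    rcases n with _ | n
    · simp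
    · simp [add_mul, PowerSeries.coeff_succ_X_mul, pow_succ, PowerSeries.coeff_one]
  rw [lamSeries_one] at h1
  linear_combination (PowerSeries.mk fun n => (-1 : A) ^ n) * h1 - lamSeries (-1 : A) * h2

theorem gam_succ_eq_lam (n : ℕ) (x : A) : gam (n + 1) x = lam (n + 1) (x + (n : A)) := by
  rw [PreLambdaRing.lam_add, Finset.Nat.sum_antidiagonal_eq_sum_range_succ_mk,
    Finset.sum_range_succ', gam_succ]
  simp only [lam_natCast]
  rw [Nat.sub_zero, Nat.choose_succ_self, Nat.cast_zero, mul_zero, add_zero]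
  refine Finset.sum_congr rfl fun i hi => ?_
  rw [Nat.add_sub_add_right, Nat.choose_symm (Nat.lt_succ_iff.1 (Finset.mem_range.1 hi)), mul_comm]

theorem gam_eq_zero {d : ℕ} {N : A} (hN : ∀ k, d < k → lam k N = 0) {k : ℕ} (hk : d < k) :
    gam k (N - d) = 0 := by
  obtain ⟨m, rfl⟩ : ∃ m, k = d + m + 1 := ⟨k - d - 1, by omega⟩
  rw [gam_succ_eq_lam, show N - (d : A) + ((d + m : ℕ) : A) = N + (m : A) by push_cast; ring,
    PreLambdaRing.lam_add]
  refine Finset.sum_eq_zero fun p hp => ?_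
  have hp' := Finset.HasAntidiagonal.mem_antidiagonal.1 hp
  by_cases h : d < p.1
  · rw [hN _ h, zero_mul]
  · rw [lam_natCast, Nat.choose_eq_zero_of_lt (by omega)]
    simp

/-- `λ_{-1}(N)` is, up to sign, the top γ-operation of `N - d`. -/
theorem lamNegOne_eq_gam (d : ℕ) (N : A) : lamNegOne d N = (-1) ^ d * gam d (N - d) := by
  rcases d with _ | d
  · simp [lamNegOne, gam_zero, PreLambdaRing.lam_zero]
  · rw [gam_succ_eq_lam, show N - ((d + 1 : ℕ) : A) + (d : A) = N + -1 by push_cast; ring,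
      PreLambdaRing.lam_add, Finset.Nat.sum_antidiagonal_eq_sum_range_succ_mk, Finset.mul_sum,
      lamNegOne]
    refine Finset.sum_congr rfl fun i hi => ?_
    have hi' := Nat.lt_succ_iff.1 (Finset.mem_range.1 hi)
    rw [← coeff_lamSeries (d + 1 - i), lamSeries_neg_one, PowerSeries.coeff_mk]
    obtain ⟨j, hj⟩ := Nat.exists_eq_add_of_le hi'
    rw [hj, Nat.add_sub_cancel_left, pow_add]
    have : ((-1 : A) ^ j) * (-1) ^ j = 1 := by rw [← mul_pow]; simp
    linear_combination (-(-1) ^ i * lam i N) * this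

/-- A line element `l`, one with `λ_t(l) = 1 + l t`, has `γ_t(l - 1) = 1 + (l - 1) t`. -/
theorem gamSeries_line {l : A} (hl : lamSeries l = 1 + PowerSeries.C l * PowerSeries.X) :
    gamSeries (l - 1) = 1 + PowerSeries.C (l - 1) * PowerSeries.X := by
  have h (y : A) (hy : lamSeries y = 1 + PowerSeries.C y * PowerSeries.X) :
      gamSeries y = 1 + PowerSeries.C y * (PowerSeries.X * PowerSeries.mk 1) := by
    ext n
    rcases n with _ | n
    · simp [gam_zero]
    · have hy' : ∀ i, lam (i + 2) y = 0 := fun i => by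
        rw [← coeff_lamSeries, hy]
        simp [PowerSeries.coeff_one]
      rw [coeff_gamSeries, gam_succ, Finset.sum_range_succ']
      simp [hy', PreLambdaRing.lam_one, PowerSeries.coeff_one, PowerSeries.coeff_succ_X_mul]
  have h1 := gamSeries_add (l - 1) 1
  rw [sub_add_cancel, h l hl, h 1 (by simp [lamSeries_one])] at h1
  have h2 := PowerSeries.mk_one_mul_one_sub_eq_one A
  rw [map_one, one_mul] at h1
  have h3 : PowerSeries.C (l - 1) = PowerSeries.C l - (1 : PowerSeries A) := by simp
  rw [h3]
  linear_combination (-(1 - PowerSeries.X)) * h1 +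
    (PowerSeries.X * PowerSeries.C l - PowerSeries.X * gamSeries (l - 1)) * h2

end LambdaRing

end LambdaRing

/-! ### Weights -/

namespace LambdaRing

section Weight

theorem intEval_X_self {V : Type*} (f : MvPolynomial V ℤ) : intEval MvPolynomial.X f = f := by
  induction f using MvPolynomial.induction_on with
  | C a => simp
  | add p q hp hq => rw [map_add, hp, hq]
  | mul_X p i hp => rw [map_mul, hp, intEval_X]

variable {V : Type*}

/-- The substitution `X_v ↦ X_v t ^ {wt v}`: the coefficient of `t ^ k` in the image of `p` is
the component of weight `k` of `p`. Thus `t ^ w` divides the image of `p` exactly if all monomials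
of `p` have weight at least `w`. -/
noncomputable def weightHom (wt : V → ℕ) :
    MvPolynomial V ℤ →+* Polynomial (MvPolynomial V ℤ) :=
  intEval fun v => Polynomial.C (MvPolynomial.X v) * Polynomial.X ^ wt v

@[simp] theorem weightHom_X (wt : V → ℕ) (v : V) : weightHom wt (MvPolynomial.X v) =
    Polynomial.C (MvPolynomial.X v) * Polynomial.X ^ wt v := by
  simp [weightHom]

theorem eval_one_weightHom (wt : V → ℕ) (p : MvPolynomial V ℤ) :
    (weightHom wt p).eval 1 = p := by
  induction p using MvPolynomial.induction_on with
  | C a => simp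
  | add p q hp hq => simp [hp, hq]
  | mul_X p i hp => simp [hp]

theorem intEval_coeff_weightHom_mem {B : Type*} [CommRing B] {F : ℕ → AddSubgroup B}
    (h1 : (1 : B) ∈ F 0) (hmul : ∀ i j a b, a ∈ F i → b ∈ F j → a * b ∈ F (i + j))
    {wt : V → ℕ} {v : V → B} (hv : ∀ i, v i ∈ F (wt i)) (p : MvPolynomial V ℤ) (k : ℕ) :
    intEval v ((weightHom wt p).coeff k) ∈ F k := by
  induction p using MvPolynomial.induction_on generalizing k with
  | C a =>
    rw [show (MvPolynomial.C a : MvPolynomial V ℤ) = ((a : ℤ) : MvPolynomial V ℤ) by simp,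
      map_intCast, ← map_intCast (Polynomial.C : MvPolynomial V ℤ →+* _), Polynomial.coeff_C]
    split_ifs with h
    · subst h
      simpa using (F 0).zsmul_mem h1 a
    · simp
  | add p q hp hq => simpa using add_mem (hp k) (hq k)
  | mul_X p i hp =>
    rw [map_mul, weightHom_X, ← mul_assoc, Polynomial.coeff_mul_X_pow']
    split_ifs with h
    · rw [Polynomial.coeff_mul_C, map_mul, intEval_X]
      have := hmul _ _ _ _ (hp (k - wt i)) (hv i)
      rwa [Nat.sub_add_cancel h] at this
    · simp

/-- A polynomial all of whose monomials have weight at least `w` takes values in the `w`-th step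
of a multiplicative filtration, provided that each variable is given a value in the step of its
weight. -/
theorem intEval_mem_of_X_pow_dvd {B : Type*} [CommRing B] {F : ℕ → AddSubgroup B}
    (hF : Antitone F)
    (h1 : (1 : B) ∈ F 0) (hmul : ∀ i j a b, a ∈ F i → b ∈ F j → a * b ∈ F (i + j))
    {wt : V → ℕ} {v : V → B} (hv : ∀ i, v i ∈ F (wt i)) {p : MvPolynomial V ℤ} {w : ℕ}
    (hp : Polynomial.X ^ w ∣ weightHom wt p) :
    intEval v p ∈ F w := by
  rw [← eval_one_weightHom wt p, Polynomial.eval_eq_sum, Polynomial.sum, map_sum]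
  refine sum_mem fun k _ => ?_
  rw [one_pow, mul_one]
  by_cases hk : k < w
  · rw [Polynomial.X_pow_dvd_iff.1 hp k hk, map_zero]
    exact zero_mem _
  · exact hF (not_lt.1 hk) (intEval_coeff_weightHom_mem h1 hmul hv p k)

end Weight

/-! ### The λ-ring of polynomials -/

section Model

variable {σ : Type u}

/-- The ideal generated by the variables. -/
noncomputable def varIdeal (σ : Type u) : Ideal (MvPolynomial σ ℤ) :=
  Ideal.span (Set.range MvPolynomial.X)

theorem X_mem_varIdeal (s : σ) : MvPolynomial.X s ∈ varIdeal σ := Ideal.subset_span ⟨s, rfl⟩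

theorem mem_varIdeal_pow_iff {w : ℕ} {f : MvPolynomial σ ℤ} :
    f ∈ varIdeal σ ^ w ↔ Polynomial.X ^ w ∣ weightHom (fun _ => 1) f := by
  constructor
  · intro h
    have h1 : (varIdeal σ).map (weightHom fun _ => 1) ≤ Ideal.span {Polynomial.X} := by
      rw [varIdeal, Ideal.map_span, Ideal.span_le]
      rintro _ ⟨_, ⟨s, rfl⟩, rfl⟩
      simp [Ideal.mem_span_singleton]
    have h2 := Ideal.mem_map_of_mem (weightHom fun _ => 1) h
    rw [Ideal.map_pow] at h2
    have h3 := Ideal.pow_right_mono h1 w h2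
    rwa [Ideal.span_singleton_pow, Ideal.mem_span_singleton] at h3
  · intro h
    have := intEval_mem_of_X_pow_dvd (F := fun k => (varIdeal σ ^ k).toAddSubgroup)
      (fun i j hij => Ideal.pow_le_pow_right hij) (by simp)
      (fun i j a b ha hb => by
        have := Ideal.mul_mem_mul ha hb
        rwa [← pow_add] at this) (v := MvPolynomial.X)
      (fun i => by simpa using X_mem_varIdeal i) h
    rwa [intEval_X_self] at this

/-- The powers of the ideal of the variables have torsion-free quotients. -/
theorem mem_varIdeal_pow_of_natCast_mul {w n : ℕ} (hn : n ≠ 0) {f : MvPolynomial σ ℤ}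
    (h : (n : MvPolynomial σ ℤ) * f ∈ varIdeal σ ^ w) : f ∈ varIdeal σ ^ w := by
  rw [mem_varIdeal_pow_iff, Polynomial.X_pow_dvd_iff] at h ⊢
  intro k hk
  have := h k hk
  rw [map_mul, map_natCast, Polynomial.coeff_natCast_mul] at this
  exact (mul_eq_zero.1 this).resolve_left (by exact_mod_cast hn)

/-- The Adams operations for which the elements `1 + X_s` are line elements. -/
noncomputable def adams (k : ℕ) : MvPolynomial σ ℤ →+* MvPolynomial σ ℤ :=
  intEval fun s => (1 + MvPolynomial.X s) ^ k - 1

@[simp] theorem adams_X (k : ℕ) (s : σ) :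
    adams k (MvPolynomial.X s) = (1 + MvPolynomial.X s) ^ k - 1 := by
  simp [adams]

theorem adams_one (f : MvPolynomial σ ℤ) : adams 1 f = f := by
  induction f using MvPolynomial.induction_on with
  | C a => simp
  | add p q hp hq => simp [hp, hq]
  | mul_X p i hp => simp [hp]

theorem adams_adams (k l : ℕ) (f : MvPolynomial σ ℤ) : adams k (adams l f) = adams (k * l) f := by
  induction f using MvPolynomial.induction_on with
  | C a => simp
  | add p q hp hq => simp [hp, hq]
  | mul_X p i hp => simp [hp, pow_mul]

/-- The ring of polynomials is additively generated by products of the line elements `1 + X_s`,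
so that every element `f` has a series `λ_t(f)`. -/
theorem exists_hasPowerSums_adams (f : MvPolynomial σ ℤ) :
    ∃ g : PowerSeries (MvPolynomial σ ℤ), PowerSeries.HasPowerSums g fun k => adams k f := by
  let M : Submonoid (MvPolynomial σ ℤ) :=
    { carrier := {f | ∀ k, adams k f = f ^ k}
      one_mem' := by simp
      mul_mem' := fun {a b} ha hb k => by rw [map_mul, ha, hb, mul_pow] }
  have hM : ∀ s : σ, 1 + MvPolynomial.X s ∈ M := fun s k => by simp
  have hf : f ∈ AddSubgroup.closure (M : Set (MvPolynomial σ ℤ)) := by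
    have h : f ∈ Subring.closure (M : Set (MvPolynomial σ ℤ)) := by
      induction f using MvPolynomial.induction_on with
      | C a => simp
      | add p q hp hq => exact add_mem hp hq
      | mul_X p i hp =>
        refine mul_mem hp ?_
        have := sub_mem (Subring.subset_closure (hM i))
          (one_mem (Subring.closure (M : Set (MvPolynomial σ ℤ))))
        simpa using this
    rw [Subring.mem_closure_iff] at h
    simpa using h
  induction hf using AddSubgroup.closure_induction with
  | mem x hx =>
    refine ⟨1 + PowerSeries.C x * PowerSeries.X, ?_⟩
    rw [show (fun k => adams k x) = fun k => x ^ k from funext fun k => hx k]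
    exact PowerSeries.HasPowerSums.linear x
  | zero => exact ⟨1, by simpa [Pi.zero_def] using PowerSeries.HasPowerSums.one⟩
  | add x y _ _ hx hy =>
    obtain ⟨g, hg⟩ := hx
    obtain ⟨h, hh⟩ := hy
    exact ⟨g * h, by simpa [Pi.add_def] using hg.mul hh⟩
  | neg x _ hx =>
    obtain ⟨g, hg⟩ := hx
    obtain ⟨h, hh⟩ := (PowerSeries.isUnit_iff_constantCoeff.2
      (show IsUnit (PowerSeries.constantCoeff g) by rw [hg.1]; exact isUnit_one)).exists_right_inv
    exact ⟨h, by simpa only [map_neg, Pi.neg_def] using hg.of_mul_eq_one hh⟩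

/-- The polynomial ring as a λ-ring, with line elements `1 + X_s`. -/
noncomputable instance instMvPolynomial (σ : Type u) : LambdaRing (MvPolynomial σ ℤ) :=
  ofAdams adams adams_one adams_adams _ fun f => (exists_hasPowerSums_adams f).choose_spec

theorem hasPowerSums_lamSeries (f : MvPolynomial σ ℤ) :
    PowerSeries.HasPowerSums (lamSeries f) fun k => adams k f := by
  have h : lamSeries f = (exists_hasPowerSums_adams f).choose := by
    ext n
    rw [coeff_lamSeries]
    rfl
  rw [h]
  exact (exists_hasPowerSums_adams f).choose_spec

theorem lamSeries_one_add_X (s : σ) : lamSeries (1 + MvPolynomial.X s : MvPolynomial σ ℤ) =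
    1 + PowerSeries.C (1 + MvPolynomial.X s) * PowerSeries.X := by
  refine (hasPowerSums_lamSeries _).ext ?_
  convert PowerSeries.HasPowerSums.linear (1 + MvPolynomial.X s : MvPolynomial σ ℤ) using 1
  ext1 k
  simp

theorem lamSeries_sum_one_add_X {κ : Type*} [Fintype κ] (b : κ → σ) :
    lamSeries (∑ i, (1 + MvPolynomial.X (b i)) : MvPolynomial σ ℤ) =
      PowerSeries.linProd fun i => 1 + MvPolynomial.X (b i) := by
  rw [lamSeries_sum, PowerSeries.linProd]
  exact Finset.prod_congr rfl fun i _ => lamSeries_one_add_X _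

theorem gamSeries_sum_X {κ : Type*} [Fintype κ] (b : κ → σ) :
    gamSeries (∑ i, MvPolynomial.X (b i) : MvPolynomial σ ℤ) =
      PowerSeries.linProd fun i => MvPolynomial.X (b i) := by
  rw [gamSeries_sum, PowerSeries.linProd]
  refine Finset.prod_congr rfl fun i _ => ?_
  simpa using gamSeries_line (lamSeries_one_add_X (b i))

theorem succ_mul_lam_succ (n : ℕ) (f : MvPolynomial σ ℤ) :
    (n + 1 : MvPolynomial σ ℤ) * lam (n + 1) f =
      ∑ i ∈ Finset.range (n + 1), lam i f * ((-1) ^ (n - i) * adams (n - i + 1) f) := by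
  simpa using (hasPowerSums_lamSeries f).coeff_succ n

theorem X_dvd_adams_X (k : ℕ) (s : σ) :
    (MvPolynomial.X s : MvPolynomial σ ℤ) ∣ adams k (MvPolynomial.X s) := by
  have := sub_dvd_pow_sub_pow (1 + MvPolynomial.X s : MvPolynomial σ ℤ) 1 k
  rwa [one_pow, add_sub_cancel_left, ← adams_X] at this

theorem dvd_adams_prod_X {κ : Type*} [Fintype κ] (b : κ → σ) (k : ℕ) :
    (∏ i, MvPolynomial.X (b i) : MvPolynomial σ ℤ) ∣ adams k (∏ i, MvPolynomial.X (b i)) := by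
  rw [map_prod]
  refine Finset.prod_dvd_prod_of_dvd _ _ fun i _ => ?_
  exact X_dvd_adams_X k (b i)

theorem adams_sub_mem_varIdeal (k : ℕ) (f : MvPolynomial σ ℤ) : adams k f - f ∈ varIdeal σ := by
  induction f using MvPolynomial.induction_on with
  | C a => simp
  | add p q hp hq => simpa [add_sub_add_comm] using add_mem hp hq
  | mul_X p i hp =>
    rw [map_mul]
    have h1 : adams k (MvPolynomial.X i) ∈ varIdeal σ :=
      Ideal.mem_of_dvd _ (X_dvd_adams_X k i) (X_mem_varIdeal i)
    exact sub_mem (Ideal.mul_mem_left _ _ h1) (Ideal.mul_mem_left _ _ (X_mem_varIdeal i))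

theorem adams_sub_mem_varIdeal_sq (k : ℕ) {f : MvPolynomial σ ℤ} (hf : f ∈ varIdeal σ) :
    adams k f - k * f ∈ varIdeal σ ^ 2 := by
  refine Submodule.span_induction ?_ (by simp) ?_ ?_ hf
  · rintro _ ⟨s, rfl⟩
    rw [adams_X]
    have hX := Ideal.pow_mem_pow (X_mem_varIdeal s) 2
    induction k with
    | zero => simp
    | succ k ih =>
      have := add_mem (Ideal.mul_mem_left _ (1 + MvPolynomial.X s) ih)
        (Ideal.mul_mem_left _ (k : MvPolynomial σ ℤ) hX)
      convert this using 1
      push_cast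
      ring
  · intro x y _ _ hx hy
    have := add_mem hx hy
    convert this using 1
    rw [map_add]
    ring
  · intro a x hx hx'
    have h1 := Ideal.mul_mem_mul (adams_sub_mem_varIdeal k a)
      (show x ∈ varIdeal σ from hx)
    rw [← sq] at h1
    have := add_mem (Ideal.mul_mem_left _ (adams k a) hx')
      (Ideal.mul_mem_left _ (k : MvPolynomial σ ℤ) h1)
    convert this using 1
    rw [smul_eq_mul, map_mul]
    ring

/-- The `k`-th Adams operation acts on the part of degree `w` of the associated graded ring as
multiplication by `k ^ w`. -/
theorem adams_sub_mem_varIdeal_pow (k : ℕ) (w : ℕ) {f : MvPolynomial σ ℤ}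
    (hf : f ∈ varIdeal σ ^ w) :
    adams k f - (k : MvPolynomial σ ℤ) ^ w * f ∈ varIdeal σ ^ (w + 1) := by
  induction w generalizing f with
  | zero => simpa using adams_sub_mem_varIdeal k f
  | succ w ih =>
    rw [pow_succ] at hf
    refine Submodule.mul_induction_on hf ?_ ?_
    · intro a ha b hb
      have h2 := adams_sub_mem_varIdeal_sq k hb
      have h3 : adams k a ∈ varIdeal σ ^ w := by
        have := add_mem (Ideal.pow_le_pow_right (Nat.le_succ w) (ih ha))
          (Ideal.mul_mem_left _ ((k : MvPolynomial σ ℤ) ^ w) ha)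
        simpa using this
      have h4 := Ideal.mul_mem_mul h3 h2
      have h5 := Ideal.mul_mem_mul (ih ha) hb
      rw [← pow_add] at h4
      rw [← pow_succ] at h5
      have := add_mem h4 (Ideal.mul_mem_left _ (k : MvPolynomial σ ℤ) h5)
      convert this using 1
      rw [map_mul]
      ring
    · intro x y hx hy
      have := add_mem hx hy
      convert this using 1
      rw [map_add]
      ring

/-- `λ^n` acts on the part of positive degree `w` of the associated graded ring as multiplication
by `(-1)^{n-1} n^{w-1}`. -/
theorem lam_add_mem_varIdeal_pow {w : ℕ} {f : MvPolynomial σ ℤ}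
    (hf : f ∈ varIdeal σ ^ (w + 1)) (n : ℕ) :
    lam (n + 1) f + (-1) ^ (n + 1) * (n + 1 : MvPolynomial σ ℤ) ^ w * f ∈
      varIdeal σ ^ (w + 2) := by
  induction n using Nat.strong_induction_on with
  | _ n ih =>
    have hlam : ∀ i < n, lam (i + 1) f ∈ varIdeal σ ^ (w + 1) := fun i hi => by
      have := sub_mem (Ideal.pow_le_pow_right (Nat.le_succ _) (ih i hi))
        (Ideal.mul_mem_left _ ((-1) ^ (i + 1) * (i + 1 : MvPolynomial σ ℤ) ^ w) hf)
      simpa using this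
    refine mem_varIdeal_pow_of_natCast_mul (n := n + 1) n.succ_ne_zero ?_
    have h1 := adams_sub_mem_varIdeal_pow (n + 1) (w + 1) hf
    have hadams : ∀ k, adams k f ∈ varIdeal σ ^ (w + 1) := fun k => by
      have := add_mem (Ideal.pow_le_pow_right (Nat.le_succ _)
        (adams_sub_mem_varIdeal_pow k (w + 1) hf))
        (Ideal.mul_mem_left _ ((k : MvPolynomial σ ℤ) ^ (w + 1)) hf)
      simpa using this
    -- all terms of the recursion but the one with `λ^0` lie in degree at least `2 (w + 1)`
    have h2 : ∑ i ∈ Finset.range n,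
        lam (i + 1) f * ((-1) ^ (n - (i + 1)) * adams (n - (i + 1) + 1) f) ∈
        varIdeal σ ^ (w + 2) := by
      refine sum_mem fun i hi => ?_
      have := Ideal.mul_mem_mul (hlam i (Finset.mem_range.1 hi))
        (Ideal.mul_mem_left _ ((-1) ^ (n - (i + 1))) (hadams (n - (i + 1) + 1)))
      rw [← pow_add] at this
      exact Ideal.pow_le_pow_right (by omega) this
    have h3 := succ_mul_lam_succ n f
    rw [Finset.sum_range_succ'] at h3
    have := add_mem h2 (Ideal.mul_mem_left _ ((-1) ^ n) h1)
    convert this using 1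
    rw [mul_add]
    push_cast
    rw [h3, PreLambdaRing.lam_zero]
    simp only [Nat.sub_zero, one_mul]
    ring

end Model

end LambdaRing

/-! ### Universal operations -/

namespace LambdaRing

section Universal

variable {d : ℕ} {ι : Type u}

/-- A family of operations, one for each λ-ring `A`, in an element `N` and a family `x`
of elements of `A`. -/
abbrev Operation (ι : Type u) : Type (u + 1) :=
  ∀ (A : Type u) [CommRing A] [LambdaRing A], A → (ι → A) → A

/-- The values of the variables of a universal operation: `Sum.inl i` stands for
`γ^{i+1}(N - d)`, and `Sum.inr (j, i)` for `γ^{i+1}(x_j)`. -/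
noncomputable def gamVal (d : ℕ) {A : Type*} [CommRing A] [PreLambdaRing A] (N : A) (x : ι → A) :
    Fin d ⊕ ι × ℕ → A :=
  Sum.elim (fun i => gam (i + 1) (N - d)) fun p => gam (p.2 + 1) (x p.1)

/-- An operation is universal if, whenever `λ^k(N) = 0` for all `k > d`, it is given by one
integral polynomial in the `γ^i(N - d)`, `1 ≤ i ≤ d`, and the `γ^i(x_j)`, `1 ≤ i`. -/
def IsUniversal (d : ℕ) (f : Operation ι) : Prop :=
  ∃ G : MvPolynomial (Fin d ⊕ ι × ℕ) ℤ, ∀ (A : Type u) [CommRing A] [LambdaRing A]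
    (N : A) (x : ι → A), (∀ k, d < k → lam k N = 0) → f A N x = intEval (gamVal d N x) G

namespace IsUniversal

theorem congr {f g : Operation ι} (hf : IsUniversal d f)
    (h : ∀ (A : Type u) [CommRing A] [LambdaRing A] (N : A) (x : ι → A),
      (∀ k, d < k → lam k N = 0) → g A N x = f A N x) : IsUniversal d g := by
  obtain ⟨G, hG⟩ := hf
  exact ⟨G, fun A _ _ N x hN => (h A N x hN).trans (hG A N x hN)⟩

theorem poly (G : MvPolynomial (Fin d ⊕ ι × ℕ) ℤ) :
    IsUniversal d fun _ _ _ N x => intEval (gamVal d N x) G :=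
  ⟨G, fun _ _ _ _ _ _ => rfl⟩

theorem intCast (a : ℤ) : IsUniversal (ι := ι) d fun A _ _ _ _ => (a : A) :=
  ⟨a, fun A _ _ N x _ => by simp⟩

theorem add {f g : Operation ι} (hf : IsUniversal d f) (hg : IsUniversal d g) :
    IsUniversal d fun A _ _ N x => f A N x + g A N x := by
  obtain ⟨F, hF⟩ := hf
  obtain ⟨G, hG⟩ := hg
  exact ⟨F + G, fun A _ _ N x hN => by simp [hF A N x hN, hG A N x hN]⟩

theorem mul {f g : Operation ι} (hf : IsUniversal d f) (hg : IsUniversal d g) :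
    IsUniversal d fun A _ _ N x => f A N x * g A N x := by
  obtain ⟨F, hF⟩ := hf
  obtain ⟨G, hG⟩ := hg
  exact ⟨F * G, fun A _ _ N x hN => by simp [hF A N x hN, hG A N x hN]⟩

theorem neg {f : Operation ι} (hf : IsUniversal d f) :
    IsUniversal d fun A _ _ N x => -f A N x := by
  obtain ⟨F, hF⟩ := hf
  exact ⟨-F, fun A _ _ N x hN => by simp [hF A N x hN]⟩

theorem sum {κ : Type*} (s : Finset κ) {f : κ → Operation ι} (hf : ∀ i ∈ s, IsUniversal d (f i)) :
    IsUniversal d fun A _ _ N x => ∑ i ∈ s, f i A N x := by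
  classical
  induction s using Finset.induction_on with
  | empty => exact (intCast 0).congr fun _ _ _ _ _ _ => by simp
  | insert a s ha ih =>
    refine ((hf a (by simp)).add (ih fun i hi => hf i (by simp [hi]))).congr
      fun _ _ _ _ _ _ => by rw [Finset.sum_insert ha]

theorem comp {τ : Type*} {g : τ → Operation ι} (hg : ∀ t, IsUniversal d (g t))
    (P : MvPolynomial τ ℤ) :
    IsUniversal d fun A _ _ N x => intEval (fun t => g t A N x) P := by
  choose G hG using hg
  refine ⟨intEval G P, fun A _ _ N x hN => ?_⟩
  have h := map_intEval (intEval (gamVal d N x)) G P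
  have h' : (fun t => g t A N x) = fun t => intEval (gamVal d N x) (G t) :=
    funext fun t => hG t A N x hN
  rw [h, ← h']

theorem gam_N_sub (k : ℕ) : IsUniversal (ι := ι) d fun _ _ _ N _ => gam k (N - d) := by
  rcases k with _ | k
  · exact (intCast 1).congr fun _ _ _ _ _ _ => by simp [gam_zero]
  · by_cases h : k < d
    · exact (poly (MvPolynomial.X (Sum.inl ⟨k, h⟩))).congr fun _ _ _ _ _ _ => by simp [gamVal]
    · exact (intCast 0).congr fun _ _ _ _ _ hN => by
        rw [gam_eq_zero hN (by omega), Int.cast_zero]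

theorem gam_var (k : ℕ) (j : ι) : IsUniversal d fun _ _ _ _ x => gam k (x j) := by
  rcases k with _ | k
  · exact (intCast 1).congr fun _ _ _ _ _ _ => by simp [gam_zero]
  · exact (poly (MvPolynomial.X (Sum.inr (j, k)))).congr fun _ _ _ _ _ _ => by simp [gamVal]

theorem lam_of_gam {f : Operation ι} (hf : ∀ n, IsUniversal d fun A _ _ N x => gam n (f A N x))
    (n : ℕ) : IsUniversal d fun A _ _ N x => lam n (f A N x) := by
  induction n using Nat.strong_induction_on with
  | _ n ih =>
    rcases n with _ | n
    · exact (hf 0).congr fun _ _ _ _ _ _ => by rw [gam_zero, PreLambdaRing.lam_zero]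
    · refine ((hf (n + 1)).add (IsUniversal.sum (Finset.range n) fun i hi =>
        (intCast (n.choose i)).mul (ih (i + 1) (by simpa using hi))).neg).congr
        fun A _ _ N x _ => ?_
      rw [gam_succ, Finset.sum_range_succ]
      simp

theorem lam_add {f g : Operation ι} (hf : ∀ n, IsUniversal d fun A _ _ N x => lam n (f A N x))
    (hg : ∀ n, IsUniversal d fun A _ _ N x => lam n (g A N x)) (n : ℕ) :
    IsUniversal d fun A _ _ N x => lam n (f A N x + g A N x) :=
  (IsUniversal.sum (Finset.HasAntidiagonal.antidiagonal n) fun p _ => (hf p.1).mul (hg p.2)).congr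
    fun _ _ _ _ _ _ => PreLambdaRing.lam_add _ _ _

theorem lam_natCast (k n : ℕ) : IsUniversal (ι := ι) d fun A _ _ _ _ => lam n (k : A) :=
  (intCast (k.choose n)).congr fun _ _ _ _ _ _ => by rw [LambdaRing.lam_natCast]; simp

theorem lam_neg {f : Operation ι} (hf : ∀ n, IsUniversal d fun A _ _ N x => lam n (f A N x))
    (n : ℕ) : IsUniversal d fun A _ _ N x => lam n (-f A N x) := by
  induction n using Nat.strong_induction_on with
  | _ n ih =>
    rcases n with _ | n
    · exact (hf 0).congr fun _ _ _ _ _ _ => by simp [PreLambdaRing.lam_zero]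
    · refine (IsUniversal.sum (Finset.range (n + 1)) fun i hi =>
        (hf (n - i + 1)).mul (ih i (by simpa using hi))).neg.congr fun A _ _ N x _ => ?_
      have h := PreLambdaRing.lam_add (n + 1) (-f A N x) (f A N x)
      rw [neg_add_cancel, lam_zero_of_pos n.succ_ne_zero,
        Finset.Nat.sum_antidiagonal_eq_sum_range_succ_mk, Finset.sum_range_succ, Nat.sub_self,
        PreLambdaRing.lam_zero, mul_one] at h
      rw [eq_neg_iff_add_eq_zero, h, add_comm]
      congr 1
      refine Finset.sum_congr rfl fun i hi => ?_
      have hi' := Finset.mem_range.1 hi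
      rw [mul_comm, show n + 1 - i = n - i + 1 by omega]

theorem lam_intCast (k : ℤ) (n : ℕ) : IsUniversal (ι := ι) d fun A _ _ _ _ => lam n (k : A) := by
  obtain ⟨k, rfl | rfl⟩ := k.eq_nat_or_neg
  · exact (lam_natCast k n).congr fun _ _ _ _ _ _ => by simp
  · exact (lam_neg (lam_natCast k) n).congr fun _ _ _ _ _ _ => by simp

theorem lam_mul {f g : Operation ι} (hf : ∀ n, IsUniversal d fun A _ _ N x => lam n (f A N x))
    (hg : ∀ n, IsUniversal d fun A _ _ N x => lam n (g A N x)) (n : ℕ) :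
    IsUniversal d fun A _ _ N x => lam n (f A N x * g A N x) := by
  refine (IsUniversal.comp (g := Sum.elim
    (fun (i : Fin n) A _ _ N x => lam (i + 1) (f A N x))
    (fun (i : Fin n) A _ _ N x => lam (i + 1) (g A N x))) ?_ (mulPoly n)).congr
      fun A _ _ N x _ => ?_
  · rintro (i | i)
    · exact hf _
    · exact hg _
  · rw [LambdaRing.lam_mul, aeval_eq_intEval]
    congr 2
    funext t
    rcases t with t | t <;> rfl

theorem lam_lam {f : Operation ι} (hf : ∀ n, IsUniversal d fun A _ _ N x => lam n (f A N x))
    (m n : ℕ) : IsUniversal d fun A _ _ N x => lam n (lam m (f A N x)) :=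
  (IsUniversal.comp (fun i : Fin (n * m) => hf (i + 1)) (compPoly n m)).congr
    fun A _ _ N x _ => by rw [LambdaRing.lam_lam, aeval_eq_intEval]

/-- Universal operations are closed under the operations `λ^n`. -/
theorem lam {f : Operation ι} (hf : IsUniversal d f) (n : ℕ) :
    IsUniversal d fun A _ _ N x => lam n (f A N x) := by
  obtain ⟨G, hG⟩ := hf
  refine IsUniversal.congr (f := fun A _ _ N x => PreLambdaRing.lam n (intEval (gamVal d N x) G)) ?_
    fun A _ _ N x hN => by rw [hG A N x hN]
  clear hG f
  have hvar {f : Operation ι} (hf : ∀ n, IsUniversal d fun A _ _ N x => gam n (f A N x))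
      (i n : ℕ) : IsUniversal d fun A _ _ N x => PreLambdaRing.lam n (gam (i + 1) (f A N x)) :=
    (lam_lam (lam_add (lam_of_gam hf) (lam_natCast i)) (i + 1) n).congr fun _ _ _ _ _ _ => by
      rw [gam_succ_eq_lam]
  induction G using MvPolynomial.induction_on generalizing n with
  | C a => exact (lam_intCast a n).congr fun _ _ _ _ _ _ => by simp
  | add p q hp hq => exact (lam_add hp hq n).congr fun _ _ _ _ _ _ => by rw [map_add]
  | mul_X p v hp =>
    have hv : ∀ n, IsUniversal d fun _ _ _ N (x : ι → _) =>
        PreLambdaRing.lam n (gamVal d N x v) := fun n => by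
      rcases v with i | ⟨j, i⟩
      · exact hvar gam_N_sub i n
      · exact hvar (fun k => gam_var k j) i n
    exact (lam_mul hp hv n).congr fun _ _ _ _ _ _ => by rw [map_mul, intEval_X]

theorem var (j : ι) : IsUniversal d fun _ _ _ _ x => x j :=
  (gam_var 1 j).congr fun _ _ _ _ _ _ => by
    rw [gam_succ]; simp [PreLambdaRing.lam_one]

theorem N : IsUniversal (ι := ι) d fun _ _ _ N _ => N :=
  ((gam_N_sub 1).add (intCast d)).congr fun _ _ _ _ _ _ => by
    rw [gam_succ]; simp [PreLambdaRing.lam_one]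

theorem lamNegOne : IsUniversal (ι := ι) d fun _ _ _ N _ => lamNegOne d N :=
  ((intCast ((-1) ^ d)).mul (gam_N_sub d)).congr fun _ _ _ _ _ _ => by
    rw [lamNegOne_eq_gam]; simp

end IsUniversal

end Universal

/-! ### The generic point -/

section Generic

variable (d : ℕ) (ι : Type u) (M : ℕ)

/-- The ring of polynomials in `y_1, …, y_d` and `z_{j,1}, …, z_{j,M}` for `j` in `ι`. -/
abbrev GenericRing : Type u := MvPolynomial (Fin d ⊕ ι × Fin M) ℤ

/-- The sum of the `d` line elements `1 + y_i`. -/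
noncomputable def genN : GenericRing d ι M := ∑ i : Fin d, (1 + MvPolynomial.X (Sum.inl i))

/-- The elements `∑ z_{j,i}`, sums of line elements minus their number. -/
noncomputable def genX (j : ι) : GenericRing d ι M := ∑ i : Fin M, MvPolynomial.X (Sum.inr (j, i))

variable {d ι M}

theorem lam_genN {k : ℕ} (hk : d < k) : lam k (genN d ι M) = 0 := by
  rw [← coeff_lamSeries, genN, lamSeries_sum_one_add_X]
  exact PowerSeries.coeff_linProd_eq_zero _ (by simpa using hk)

theorem genN_sub : genN d ι M - (d : GenericRing d ι M) =
    ∑ i : Fin d, MvPolynomial.X (Sum.inl i) := by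
  simp [genN, Finset.sum_add_distrib]

theorem gam_genN_sub (k : ℕ) : gam k (genN d ι M - (d : GenericRing d ι M)) = PowerSeries.coeff k
    (PowerSeries.linProd fun i : Fin d => (MvPolynomial.X (Sum.inl i) : GenericRing d ι M)) := by
  rw [← coeff_gamSeries, genN_sub, gamSeries_sum_X]

theorem gam_genX (k : ℕ) (j : ι) : gam k (genX d ι M j) = PowerSeries.coeff k
    (PowerSeries.linProd fun i => (MvPolynomial.X (Sum.inr (j, i)) : GenericRing d ι M)) := by
  rw [← coeff_gamSeries, genX, gamSeries_sum_X]

/-- Over an algebraically closed field, the values of the elementary symmetric functions of the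
blocks of variables can be prescribed. -/
theorem exists_point {K : Type*} [Field K] [IsAlgClosed K] (a : Fin d ⊕ ι × Fin M → K) :
    ∃ v : Fin d ⊕ ι × Fin M → K,
      (∀ i : Fin d, PowerSeries.coeff (i + 1) (PowerSeries.linProd fun i => v (Sum.inl i)) =
        a (Sum.inl i)) ∧
      ∀ (j : ι) (i : Fin M), PowerSeries.coeff (i + 1)
        (PowerSeries.linProd fun i => v (Sum.inr (j, i))) = a (Sum.inr (j, i)) := by
  obtain ⟨y, hy⟩ := PowerSeries.exists_coeff_linProd d fun i => a (Sum.inl i)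
  choose z hz using fun j => PowerSeries.exists_coeff_linProd M fun i => a (Sum.inr (j, i))
  exact ⟨Sum.elim y fun p => z p.1 p.2, hy, fun j => hz j⟩

theorem intEval_injective {K : Type*} [Field K] [CharZero K] {V : Type*} {p : MvPolynomial V ℤ}
    (h : ∀ a : V → K, intEval a p = 0) : p = 0 := by
  apply MvPolynomial.map_injective (Int.castRingHom K) Int.cast_injective
  rw [map_zero]
  refine MvPolynomial.funext fun a => ?_
  rw [MvPolynomial.eval_map, map_zero]
  exact h a

/-- The inclusion of the variables of the first `M` operations. -/
def trunc (d : ℕ) (ι : Type u) (M : ℕ) : Fin d ⊕ ι × Fin M → Fin d ⊕ ι × ℕ :=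
  Sum.map id (Prod.map id Fin.val)

theorem exists_rename_trunc (G : MvPolynomial (Fin d ⊕ ι × ℕ) ℤ) :
    ∃ (M : ℕ) (H : MvPolynomial (Fin d ⊕ ι × Fin M) ℤ),
      MvPolynomial.rename (trunc d ι M) H = G := by
  let M := G.vars.sup (Sum.elim (fun _ => 0) fun p => p.2 + 1)
  refine ⟨M, MvPolynomial.exists_rename_eq_of_vars_subset_range G (trunc d ι M) ?_ ?_⟩
  · exact Function.Injective.sumMap Function.injective_id
      (Function.Injective.prodMap Function.injective_id Fin.val_injective)
  · rintro (i | ⟨j, i⟩) h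
    · exact ⟨Sum.inl i, rfl⟩
    · have : i + 1 ≤ M := Finset.le_sup
        (f := Sum.elim (fun _ : Fin d => 0) fun p : ι × ℕ => p.2 + 1) h
      exact ⟨Sum.inr (j, ⟨i, this⟩), rfl⟩

theorem intEval_rename {V W B : Type*} [CommRing B] (g : V → W) (v : W → B)
    (p : MvPolynomial V ℤ) :
    intEval v (MvPolynomial.rename g p) = intEval (fun i => v (g i)) p := by
  simp [intEval, MvPolynomial.eval₂_rename, Function.comp_def]

/-- Evaluating a polynomial at the generic elements and then at a point amounts to evaluating it
at the elementary symmetric functions of the coordinates. -/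
theorem intEval_gamVal_gen {K : Type*} [CommRing K] (v : Fin d ⊕ ι × Fin M → K)
    (G : MvPolynomial (Fin d ⊕ ι × ℕ) ℤ) :
    intEval v (intEval (gamVal d (genN d ι M) (genX d ι M)) G) =
      intEval (Sum.elim
        (fun i : Fin d => PowerSeries.coeff (i + 1) (PowerSeries.linProd fun i => v (Sum.inl i)))
        fun p : ι × ℕ => PowerSeries.coeff (p.2 + 1)
          (PowerSeries.linProd fun i => v (Sum.inr (p.1, i)))) G := by
  rw [map_intEval]
  congr 2
  funext i
  rcases i with i | ⟨j, i⟩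
  · simp [gamVal, gam_genN_sub, ← PowerSeries.coeff_map, PowerSeries.map_linProd]
  · simp [gamVal, gam_genX, ← PowerSeries.coeff_map, PowerSeries.map_linProd]

/-- The values of the truncated operations at the generic elements are algebraically
independent. -/
theorem eq_zero_of_intEval_gen {H : MvPolynomial (Fin d ⊕ ι × Fin M) ℤ}
    (h : intEval (gamVal d (genN d ι M) (genX d ι M)) (MvPolynomial.rename (trunc d ι M) H) = 0) :
    H = 0 := by
  refine intEval_injective (K := ℂ) fun a => ?_
  obtain ⟨v, hv, hv'⟩ := exists_point a
  have h1 := intEval_gamVal_gen v (MvPolynomial.rename (trunc d ι M) H)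
  rw [h, map_zero, intEval_rename] at h1
  rw [h1]
  congr 2
  funext i
  rcases i with i | ⟨j, i⟩
  · exact (hv i).symm
  · exact (hv' j i).symm

end Generic

end LambdaRing

/-! ### Existence and uniqueness of the twisted operations -/

namespace LambdaRing

section Twisted

variable {d : ℕ}

/-- The values of the variables of `evalAt d Q N x`. -/
def lamVal (d : ℕ) {A : Type*} [CommRing A] [PreLambdaRing A] (N x : A) : Fin d ⊕ ℕ → A :=
  Sum.elim (fun i : Fin d => lam (i + 1) N) fun j : ℕ => lam (j + 1) x

theorem evalAt_eq {A : Type*} [CommRing A] [PreLambdaRing A] (Q : MvPolynomial (Fin d ⊕ ℕ) ℤ)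
    (N x : A) : evalAt d Q N x = intEval (lamVal d N x) Q := rfl

theorem prod_X_ne_zero {ι : Type u} {M : ℕ} :
    (∏ i : Fin d, MvPolynomial.X (Sum.inl i) : GenericRing d ι M) ≠ 0 :=
  Finset.prod_ne_zero_iff.2 fun _ _ => MvPolynomial.X_ne_zero _

theorem lamNegOne_genN {ι : Type u} {M : ℕ} :
    lamNegOne d (genN d ι M) = (-1) ^ d * ∏ i : Fin d, MvPolynomial.X (Sum.inl i) := by
  rw [lamNegOne_eq_gam, gam_genN_sub]
  congr 1
  have := PowerSeries.coeff_card_linProd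
    (fun i : Fin d => (MvPolynomial.X (Sum.inl i) : GenericRing d ι M))
  rwa [Fintype.card_fin] at this

theorem lamNegOne_genN_ne_zero {ι : Type u} {M : ℕ} : lamNegOne d (genN d ι M) ≠ 0 := by
  rw [lamNegOne_genN]
  exact mul_ne_zero (pow_ne_zero _ (neg_ne_zero.2 one_ne_zero)) prod_X_ne_zero

theorem X_dvd_sub_intEval {V : Type*} [DecidableEq V] (v : V) (F : MvPolynomial V ℤ) :
    MvPolynomial.X v ∣ F - intEval (fun i => if i = v then 0 else MvPolynomial.X i) F := by
  induction F using MvPolynomial.induction_on with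
  | C a => simp
  | add p q hp hq => simpa [add_sub_add_comm] using dvd_add hp hq
  | mul_X p i hp =>
    rw [map_mul, intEval_X]
    split_ifs with h
    · subst h
      simp
    · rw [← sub_mul]
      exact hp.mul_right _

/-- Divisibility by a variable can be tested on points. -/
theorem X_dvd_of_intEval {K : Type*} [Field K] [CharZero K] {V : Type*} {v : V}
    {F : MvPolynomial V ℤ} (h : ∀ a : V → K, a v = 0 → intEval a F = 0) :
    MvPolynomial.X v ∣ F := by
  classical
  have h0 : intEval (fun i => if i = v then 0 else MvPolynomial.X i) F =
      (0 : MvPolynomial V ℤ) := by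
    refine intEval_injective (K := K) fun a => ?_
    rw [map_intEval]
    exact h _ (by simp)
  simpa [h0] using X_dvd_sub_intEval v F

/-- If `f` is divisible by `y_1 ⋯ y_d`, then so is a nonzero integral multiple of `λ^{n+1}(f)`, which
is all that matters for its values at the points with `y_1 ⋯ y_d = 0`. -/
theorem prod_X_dvd_mul_lam {ι : Type u} {M : ℕ} (n : ℕ) (g c : GenericRing d ι M) :
    (∏ i : Fin d, MvPolynomial.X (Sum.inl i) : GenericRing d ι M) ∣
      (n + 1 : GenericRing d ι M) *
        lam (n + 1) (g * (c * ∏ i : Fin d, MvPolynomial.X (Sum.inl i))) := by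
  rw [succ_mul_lam_succ]
  refine Finset.dvd_sum fun i _ => ?_
  rw [map_mul, map_mul]
  exact (((dvd_adams_prod_X _ _).mul_left _).mul_left _).mul_left _ |>.mul_left _

/-- The universal polynomial for `λ^{n+1}(x λ_{-1}(N))` is divisible by the one for `λ_{-1}(N)`. -/
theorem exists_universal_quotient (d n : ℕ) :
    ∃ H : MvPolynomial (Fin d ⊕ PUnit.{u + 1} × ℕ) ℤ, ∀ (A : Type u) [CommRing A] [LambdaRing A]
      (N : A) (x : PUnit.{u + 1} → A), (∀ k, d < k → lam k N = 0) →
      lam (n + 1) (x PUnit.unit * lamNegOne d N) =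
        intEval (gamVal d N x) H * lamNegOne d N := by
  obtain ⟨F, hF⟩ := (((IsUniversal.var (d := d) PUnit.unit.{u + 1}).mul
    IsUniversal.lamNegOne).lam (n + 1))
  beta_reduce at hF
  rcases d with _ | d
  · refine ⟨F, fun A _ _ N x hN => ?_⟩
    rw [hF A N x hN]
    simp [lamNegOne, PreLambdaRing.lam_zero]
  · obtain ⟨H, rfl⟩ : MvPolynomial.X (Sum.inl (Fin.last d)) ∣ F := by
      -- a point with vanishing last coordinate comes from a point with `y_1 ⋯ y_{d+1} = 0`
      refine X_dvd_of_intEval (K := ℂ) fun a ha => ?_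
      obtain ⟨M, G, rfl⟩ := exists_rename_trunc F
      obtain ⟨v, hv, hv'⟩ := exists_point fun i => a (trunc (d + 1) _ M i)
      have h1 := intEval_gamVal_gen v (MvPolynomial.rename (trunc (d + 1) _ M) G)
      rw [← hF _ _ _ fun k => lam_genN, intEval_rename] at h1
      have h2 : (∏ i, v (Sum.inl i)) = 0 := by
        have h3 := PowerSeries.coeff_card_linProd fun i => v (Sum.inl i)
        rw [← h3, Fintype.card_fin]
        exact (hv (Fin.last d)).trans ha
      rw [intEval_rename]
      refine Eq.trans ?_ (h1.symm.trans ?_)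
      · congr 2
        funext i
        rcases i with i | ⟨j, i⟩
        · exact (hv i).symm
        · exact (hv' j i).symm
      · obtain ⟨r, hr⟩ := prod_X_dvd_mul_lam n
          (genX (d + 1) PUnit.{u + 1} M PUnit.unit) ((-1) ^ (d + 1))
        have h4 := congrArg (intEval v) hr
        rw [map_mul, map_mul _ _ r, map_prod] at h4
        simp only [intEval_X, h2, zero_mul] at h4
        rw [lamNegOne_genN]
        refine (mul_eq_zero.1 h4).resolve_left ?_
        rw [map_add, map_natCast, map_one]
        exact Nat.cast_add_one_ne_zero n
    refine ⟨(-1) ^ (d + 1) * H, fun A _ _ N x hN => ?_⟩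
    rw [hF A N x hN, lamNegOne_eq_gam, map_mul, map_mul, intEval_X]
    have h5 : ((-1 : A) ^ (d + 1)) * (-1) ^ (d + 1) = 1 := by rw [← mul_pow]; simp
    simp only [gamVal, Sum.elim_inl, Fin.val_last, map_pow, map_neg, map_one]
    linear_combination (-gam (d + 1) (N - ((d + 1 : ℕ) : A)) *
      intEval (Sum.elim (fun i : Fin (d + 1) => gam (i + 1) (N - ((d + 1 : ℕ) : A)))
        fun p => gam (p.2 + 1) (x p.1)) H) * h5

/-- `λ^n` takes the same integral value at a given integer in all λ-rings. -/
theorem exists_lam_intCast (k : ℤ) (n : ℕ) :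
    ∃ z : ℤ, ∀ (A : Type u) [CommRing A] [LambdaRing A], lam n (k : A) = z := by
  obtain ⟨G, hG⟩ := IsUniversal.lam_intCast (d := 0) (ι := PEmpty.{u + 1}) k n
  obtain ⟨z, rfl⟩ := MvPolynomial.C_surjective (R := ℤ) (Fin 0 ⊕ PEmpty.{u + 1} × ℕ) G
  refine ⟨z, fun A _ _ => ?_⟩
  simpa using hG A 0 PEmpty.elim fun k hk => lam_zero_of_pos hk.ne'

theorem exists_evalAt_eq_lam (d i : ℕ) :
    ∃ P : MvPolynomial (Fin d ⊕ ℕ) ℤ, ∀ (A : Type u) [CommRing A] [LambdaRing A]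
      (N x : A), (∀ k, d < k → lam k N = 0) → lam i N = intEval (lamVal d N x) P := by
  rcases i with _ | i
  · exact ⟨1, fun A _ _ N x _ => by simp [PreLambdaRing.lam_zero]⟩
  · by_cases h : i < d
    · exact ⟨MvPolynomial.X (Sum.inl ⟨i, h⟩), fun A _ _ N x _ => by simp [lamVal]⟩
    · exact ⟨0, fun A _ _ N x hN => by rw [hN _ (by omega), map_zero]⟩

/-- The `γ^i(N - d)` and `γ^i(x)` are integral polynomials in the `λ^i(N)` and `λ^i(x)`. -/
theorem exists_evalAt_eq_gamVal (d : ℕ) (v : Fin d ⊕ PUnit.{u + 1} × ℕ) :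
    ∃ P : MvPolynomial (Fin d ⊕ ℕ) ℤ, ∀ (A : Type u) [CommRing A] [LambdaRing A]
      (N x : A), (∀ k, d < k → lam k N = 0) →
      gamVal d N (fun _ => x) v = intEval (lamVal d N x) P := by
  rcases v with i | ⟨_, k⟩
  · choose P hP using exists_evalAt_eq_lam.{u} d
    choose z hz using fun b => exists_lam_intCast.{u} ((i : ℤ) - d) b
    refine ⟨∑ p ∈ Finset.HasAntidiagonal.antidiagonal (i.val + 1),
      P p.1 * (z p.2 : MvPolynomial _ ℤ),
      fun A _ _ N x hN => ?_⟩
    have h : N - (d : A) + (i.val : A) = N + (((i : ℤ) - d : ℤ) : A) := by push_cast; ring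
    simp only [gamVal, Sum.elim_inl]
    rw [gam_succ_eq_lam, h, PreLambdaRing.lam_add, map_sum]
    refine Finset.sum_congr rfl fun p _ => ?_
    rw [hP _ A N x hN, hz, map_mul, map_intCast]
  · refine ⟨∑ i ∈ Finset.range (k + 1), (k.choose i : MvPolynomial _ ℤ) *
      MvPolynomial.X (Sum.inr i), fun A _ _ N x _ => ?_⟩
    simp [gamVal, lamVal, gam_succ]

theorem exists_isTwistedPoly (d n : ℕ) :
    ∃ Q : MvPolynomial (Fin d ⊕ ℕ) ℤ, IsTwistedPoly.{u} d (n + 1) Q := by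
  obtain ⟨H, hH⟩ := exists_universal_quotient.{u} d n
  choose P hP using exists_evalAt_eq_gamVal.{u} d
  refine ⟨intEval P H, fun A _ _ N x hN => ?_⟩
  have h1 := hH A N (fun _ => x) hN
  have h2 := map_intEval (intEval (lamVal d N x)) P H
  have h3 : gamVal d N (fun _ : PUnit.{u + 1} => x) = fun i => intEval (lamVal d N x) (P i) :=
    funext fun v => hP v A N x hN
  rw [evalAt_eq, h2, ← h3, h1]

theorem IsTwistedPoly.unique {n : ℕ} {Q Q' : MvPolynomial (Fin d ⊕ ℕ) ℤ}
    (hQ : IsTwistedPoly.{u} d n Q) (hQ' : IsTwistedPoly.{u} d n Q') : Q = Q' := by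
  let e : Fin d ⊕ ℕ → Fin d ⊕ PUnit.{u + 1} × ℕ := Sum.map id fun i => (PUnit.unit, i)
  have he : Function.Injective e :=
    Function.Injective.sumMap Function.injective_id fun a b h => by simpa using h
  rw [← sub_eq_zero]
  apply MvPolynomial.rename_injective e he
  rw [map_zero]
  obtain ⟨M, H, hH⟩ := exists_rename_trunc (MvPolynomial.rename e (Q - Q'))
  -- the variables are taken at `∑ (1 + y_i)` and `∑ (1 + z_i)`, whose `λ`-operations are the
  -- elementary symmetric functions of the `1 + y_i` and of the `1 + z_i`
  let N := genN d PUnit.{u + 1} M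
  let x : GenericRing d PUnit.{u + 1} M :=
    ∑ i : Fin M, (1 + MvPolynomial.X (Sum.inr (PUnit.unit, i)))
  have hD : intEval (lamVal d N x) (Q - Q') = 0 := by
    rw [map_sub, sub_eq_zero]
    refine mul_right_cancel₀ (lamNegOne_genN_ne_zero (d := d) (ι := PUnit.{u + 1}) (M := M)) ?_
    have h1 := hQ _ N x fun k => lam_genN
    have h2 := hQ' _ N x fun k => lam_genN
    exact h1.symm.trans h2
  rw [← hH]
  suffices h : H = 0 by rw [h, map_zero]
  refine intEval_injective (K := ℂ) fun a => ?_
  obtain ⟨v, hv, hv'⟩ := exists_point a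
  have h0 := congrArg (intEval fun i => v i - 1) hD
  rw [map_zero, map_intEval] at h0
  let w : Fin d ⊕ PUnit.{u + 1} × ℕ → ℂ := Sum.elim
    (fun i => PowerSeries.coeff (i + 1) (PowerSeries.linProd fun i => v (Sum.inl i)))
    fun p => PowerSeries.coeff (p.2 + 1) (PowerSeries.linProd fun i => v (Sum.inr (p.1, i)))
  have hw : (fun t => intEval (fun i => v i - 1) (lamVal d N x t)) = fun t => w (e t) := by
    funext t
    rcases t with t | t
    · simp only [lamVal, Sum.elim_inl, N, genN, e, w, Sum.map_inl, id]
      rw [← coeff_lamSeries, lamSeries_sum_one_add_X, ← PowerSeries.coeff_map,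
        PowerSeries.map_linProd]
      simp
    · simp only [lamVal, Sum.elim_inr, x, e, w, Sum.map_inr]
      rw [← coeff_lamSeries, lamSeries_sum_one_add_X, ← PowerSeries.coeff_map,
        PowerSeries.map_linProd]
      simp
  have ha : a = fun i => w (trunc d _ M i) := by
    funext i
    rcases i with i | ⟨j, i⟩
    · exact (hv i).symm
    · exact (hv' j i).symm
  rw [ha, ← intEval_rename, hH, intEval_rename, ← hw, h0]

theorem existsUnique_isTwistedPoly (d n : ℕ) :
    ∃! Q : MvPolynomial (Fin d ⊕ ℕ) ℤ, IsTwistedPoly.{u} d (n + 1) Q := by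
  obtain ⟨Q, hQ⟩ := exists_isTwistedPoly.{u} d n
  exact ⟨Q, hQ, fun Q' hQ' => hQ'.unique hQ⟩

end Twisted

end LambdaRing

/-! ### The γ-filtration -/

namespace LambdaRing

section Filtration

variable {R : Type u} [CommRing R] [LambdaRing R] {ε : R →+* ℤ}

theorem gammaFil_antitone : Antitone (gammaFil ε) := by
  intro p q hpq
  refine AddSubgroup.closure_mono ?_
  rintro _ ⟨l, hl, hq, rfl⟩
  exact ⟨l, hl, hpq.trans hq, rfl⟩

theorem one_mem_gammaFil : (1 : R) ∈ gammaFil ε 0 :=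
  AddSubgroup.subset_closure ⟨[], by simp, by simp, by simp⟩

theorem mul_mem_gammaFil (p q : ℕ) (a b : R) (ha : a ∈ gammaFil ε p) (hb : b ∈ gammaFil ε q) :
    a * b ∈ gammaFil ε (p + q) := by
  induction ha using AddSubgroup.closure_induction with
  | mem x hx =>
    induction hb using AddSubgroup.closure_induction with
    | mem y hy =>
      obtain ⟨l, hl, hp, rfl⟩ := hx
      obtain ⟨l', hl', hq, rfl⟩ := hy
      refine AddSubgroup.subset_closure ⟨l ++ l', ?_, ?_, ?_⟩
      · intro z hz
        rcases List.mem_append.1 hz with hz | hz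
        · exact hl z hz
        · exact hl' z hz
      · simpa using add_le_add hp hq
      · simp
    | zero => simp
    | add y z _ _ hy hz => rw [mul_add]; exact add_mem hy hz
    | neg y _ hy => rw [mul_neg]; exact neg_mem hy
  | zero => simp
  | add y z _ _ hy hz => rw [add_mul]; exact add_mem hy hz
  | neg y _ hy => rw [neg_mul]; exact neg_mem hy

theorem gam_mem_gammaFil (k : ℕ) {y : R} (hy : ε y = 0) : gam k y ∈ gammaFil ε k :=
  AddSubgroup.subset_closure ⟨[(k, y)], by simpa using hy, by simp, by simp⟩

/-- The weights of the variables standing for the `γ^i(N - d)` and the `γ^i(x_j)`. -/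
def gamWt (d : ℕ) (ι : Type u) : Fin d ⊕ ι × ℕ → ℕ :=
  Sum.elim (fun i => i.val + 1) fun p => p.2 + 1

/-- The values of the polynomials with all weights at least `q` lie in `Fil^q`. -/
theorem intEval_mem_gammaFil {d : ℕ} {N : R} (hrank : ε N = d) {q : ℕ}
    {P : MvPolynomial (Fin d ⊕ {y : R // ε y = 0} × ℕ) ℤ}
    (hP : Polynomial.X ^ q ∣ weightHom (gamWt d _) P) :
    intEval (gamVal d N Subtype.val) P ∈ gammaFil ε q := by
  refine intEval_mem_of_X_pow_dvd gammaFil_antitone one_mem_gammaFil mul_mem_gammaFil ?_ hP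
  rintro (i | ⟨j, i⟩)
  · exact gam_mem_gammaFil _ (by simp [hrank])
  · exact gam_mem_gammaFil _ j.2

/-- Every element of `Fil^q` is the value of a polynomial with all weights at least `q`, in
variables that stand for the `γ^i(y)`, one for each `y` with `ε(y) = 0`. -/
theorem exists_eq_intEval_of_mem_gammaFil (d : ℕ) (N : R) {q : ℕ} {x : R} (hx : x ∈ gammaFil ε q) :
    ∃ P : MvPolynomial (Fin d ⊕ {y : R // ε y = 0} × ℕ) ℤ,
      Polynomial.X ^ q ∣ weightHom (gamWt d _) P ∧ intEval (gamVal d N Subtype.val) P = x := by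
  induction hx using AddSubgroup.closure_induction with
  | mem x hx =>
    obtain ⟨l, hl, hq, rfl⟩ := hx
    suffices h : ∃ P : MvPolynomial (Fin d ⊕ {y : R // ε y = 0} × ℕ) ℤ,
        Polynomial.X ^ (l.map fun p => p.1).sum ∣ weightHom (gamWt d _) P ∧
        intEval (gamVal d N Subtype.val) P = (l.map fun p => gam p.1 p.2).prod by
      obtain ⟨P, hP, hP'⟩ := h
      exact ⟨P, (pow_dvd_pow _ hq).trans hP, hP'⟩
    clear hq
    induction l with
    | nil => exact ⟨1, by simp⟩
    | cons p l ih =>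
      obtain ⟨P, hP, hP'⟩ := ih fun p hp => hl p (by simp [hp])
      obtain ⟨k, y⟩ := p
      rcases k with _ | k
      · exact ⟨P, by simpa using hP, by simp [hP', gam_zero]⟩
      · have hy : ε y = 0 := hl (k + 1, y) (by simp)
        refine ⟨MvPolynomial.X (Sum.inr (⟨y, hy⟩, k)) * P, ?_, ?_⟩
        · rw [List.map_cons, List.sum_cons, pow_add, map_mul, weightHom_X]
          exact mul_dvd_mul (Dvd.intro_left _ rfl) hP
        · rw [map_mul, intEval_X, hP']
          simp [gamVal]
  | zero => exact ⟨0, by simp⟩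
  | add x y _ _ hx hy =>
    obtain ⟨P, hP, rfl⟩ := hx
    obtain ⟨Q, hQ, rfl⟩ := hy
    exact ⟨P + Q, by rw [map_add]; exact dvd_add hP hQ, by rw [map_add]⟩
  | neg x _ hx =>
    obtain ⟨P, hP, rfl⟩ := hx
    exact ⟨-P, by rw [map_neg]; exact (dvd_neg).2 hP, by rw [map_neg]⟩

end Filtration

/-! ### Weights at the generic point -/

section GenericWeight

variable {d : ℕ} {ι : Type u} {M : ℕ}

/-- At the generic point, weights become degrees. -/
theorem weightHom_gamVal (v : Fin d ⊕ ι × ℕ) :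
    weightHom (fun _ => 1) (gamVal d (genN d ι M) (genX d ι M) v) =
      Polynomial.C (gamVal d (genN d ι M) (genX d ι M) v) * Polynomial.X ^ gamWt d ι v := by
  have h {κ : Type} [Fintype κ] (b : κ → Fin d ⊕ ι × Fin M) (k : ℕ) :
      weightHom (fun _ => 1) (PowerSeries.coeff k
        (PowerSeries.linProd fun i => (MvPolynomial.X (b i) : GenericRing d ι M))) =
      Polynomial.C (PowerSeries.coeff k
        (PowerSeries.linProd fun i => (MvPolynomial.X (b i) : GenericRing d ι M))) *
        Polynomial.X ^ k := by
    rw [mul_comm]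
    refine PowerSeries.map_coeff_linProd_of_eq_mul (fun i => ?_) k
    rw [weightHom_X, pow_one, mul_comm]
  rcases v with i | ⟨j, i⟩
  · simp only [gamVal, Sum.elim_inl, gam_genN_sub, gamWt]
    exact h _ _
  · simp only [gamVal, Sum.elim_inr, gam_genX, gamWt]
    exact h _ _

theorem weightHom_intEval (G : MvPolynomial (Fin d ⊕ ι × ℕ) ℤ) :
    weightHom (fun _ => 1) (intEval (gamVal d (genN d ι M) (genX d ι M)) G) =
      (weightHom (gamWt d ι) G).map (intEval (gamVal d (genN d ι M) (genX d ι M))) := by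
  induction G using MvPolynomial.induction_on with
  | C a => simp
  | add p q hp hq => rw [map_add, map_add, map_add, Polynomial.map_add, hp, hq]
  | mul_X p v hp =>
    rw [map_mul, map_mul, map_mul, Polynomial.map_mul, hp, intEval_X, weightHom_gamVal,
      weightHom_X, Polynomial.map_mul, Polynomial.map_C, Polynomial.map_pow, Polynomial.map_X,
      intEval_X]

theorem weightHom_rename {V W : Type*} (wt : W → ℕ) (g : V → W) (p : MvPolynomial V ℤ) :
    weightHom wt (MvPolynomial.rename g p) =
      (weightHom (fun i => wt (g i)) p).map (MvPolynomial.rename g).toRingHom := by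
  induction p using MvPolynomial.induction_on with
  | C a => simp
  | add p q hp hq => rw [map_add, map_add, map_add, Polynomial.map_add, hp, hq]
  | mul_X p v hp =>
    rw [map_mul, map_mul, map_mul, Polynomial.map_mul, hp, MvPolynomial.rename_X, weightHom_X,
      weightHom_X, Polynomial.map_mul, Polynomial.map_C, Polynomial.map_pow, Polynomial.map_X]
    simp

theorem intEval_gen_mem_varIdeal_pow {q : ℕ} {P : MvPolynomial (Fin d ⊕ ι × ℕ) ℤ}
    (hP : Polynomial.X ^ q ∣ weightHom (gamWt d ι) P) :
    intEval (gamVal d (genN d ι M) (genX d ι M)) P ∈ varIdeal _ ^ q := by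
  rw [mem_varIdeal_pow_iff, weightHom_intEval]
  have := map_dvd (Polynomial.mapRingHom (intEval (gamVal d (genN d ι M) (genX d ι M)))) hP
  simpa using this

/-- The weights of a polynomial can be read off from the degree of its generic values, by the
algebraic independence of the variables. -/
theorem X_pow_dvd_weightHom_of_gen {q : ℕ} {G : MvPolynomial (Fin d ⊕ ι × ℕ) ℤ}
    (hG : ∀ M, Polynomial.X ^ q ∣
      weightHom (fun _ => 1) (intEval (gamVal d (genN d ι M) (genX d ι M)) G)) :
    Polynomial.X ^ q ∣ weightHom (gamWt d ι) G := by
  obtain ⟨M, H, rfl⟩ := exists_rename_trunc G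
  have h := hG M
  rw [weightHom_intEval, weightHom_rename, Polynomial.map_map] at h
  rw [weightHom_rename]
  rw [Polynomial.X_pow_dvd_iff] at h ⊢
  intro k hk
  have h1 := h k hk
  rw [Polynomial.coeff_map] at h1 ⊢
  rw [eq_zero_of_intEval_gen h1, map_zero]

/-- Dividing by `y_1 ⋯ y_d` lowers degrees by `d`. -/
theorem X_pow_dvd_of_mul_prod_mem {q : ℕ} {f : GenericRing d ι M}
    (h : f * ∏ i : Fin d, MvPolynomial.X (Sum.inl i) ∈ varIdeal _ ^ (q + d)) :
    Polynomial.X ^ q ∣ weightHom (fun _ => 1) f := by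
  rw [mem_varIdeal_pow_iff, map_mul, map_prod] at h
  simp only [weightHom_X, pow_one] at h
  rw [Finset.prod_mul_distrib, Finset.prod_const, Finset.card_univ, Fintype.card_fin,
    ← map_prod, ← mul_assoc] at h
  rw [Polynomial.X_pow_dvd_iff] at h ⊢
  intro k hk
  have h1 := h (k + d) (by omega)
  rw [Polynomial.coeff_mul_X_pow, Polynomial.coeff_mul_C] at h1
  exact (mul_eq_zero.1 h1).resolve_right prod_X_ne_zero

end GenericWeight

/-! ### The twisted operations on the graded ring -/

section Main

variable {d : ℕ} {ι : Type u}

theorem IsUniversal.evalAt {f : Operation ι} (hf : IsUniversal d f)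
    (Q : MvPolynomial (Fin d ⊕ ℕ) ℤ) :
    IsUniversal d fun _ _ _ N x => evalAt d Q N (f _ N x) := by
  refine (IsUniversal.comp (g := Sum.elim
    (fun (i : Fin d) _ _ _ N _ => PreLambdaRing.lam (i + 1) N)
    (fun (j : ℕ) _ _ _ N x => PreLambdaRing.lam (j + 1) (f _ N x))) ?_ Q).congr
      fun A _ _ N x _ => ?_
  · rintro (i | j)
    · exact IsUniversal.N.lam _
    · exact hf.lam _
  · rw [evalAt_eq]
    congr 2
    funext t
    rcases t with t | t <;> rfl

/-- At the generic point, `λ^n(N, -) + (-1)^n n^{q+d-1}` raises degrees: multiplied by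
`λ_{-1}(N)`, which has degree `d`, this is the behaviour of `λ^n` in degree `q + d`. -/
theorem X_pow_dvd_gen {M n q w : ℕ} (hw : q + d = w + 1) {Q : MvPolynomial (Fin d ⊕ ℕ) ℤ}
    (hQ : IsTwistedPoly.{u} d (n + 1) Q) {f : GenericRing d ι M} (hf : f ∈ varIdeal _ ^ q) :
    Polynomial.X ^ (q + 1) ∣ weightHom (fun _ => 1) (evalAt d Q (genN d ι M) f +
      (-1) ^ (n + 1) * (n + 1 : GenericRing d ι M) ^ w * f) := by
  apply X_pow_dvd_of_mul_prod_mem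
  have hE : lamNegOne d (genN d ι M) ∈ varIdeal (Fin d ⊕ ι × Fin M) ^ d := by
    rw [lamNegOne_genN]
    refine Ideal.mul_mem_left _ _ ?_
    have := Ideal.prod_mem_prod (s := Finset.univ)
      (I := fun _ : Fin d => varIdeal (Fin d ⊕ ι × Fin M))
      (x := fun i => MvPolynomial.X (Sum.inl i)) fun i _ => X_mem_varIdeal _
    simpa using this
  have h1 := Ideal.mul_mem_mul hf hE
  rw [← pow_add, hw] at h1
  have h2 := lam_add_mem_varIdeal_pow h1 n
  rw [hQ _ _ f fun k => lam_genN] at h2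
  have h3 := Ideal.mul_mem_left _ ((-1) ^ d) h2
  rw [show q + 1 + d = w + 2 by omega]
  convert h3 using 1
  have h4 : ((-1 : GenericRing d ι M) ^ d) * (-1) ^ d = 1 := by rw [← mul_pow]; simp
  rw [lamNegOne_genN]
  linear_combination (-(evalAt d Q (genN d ι M) f +
      (-1) ^ (n + 1) * (n + 1 : GenericRing d ι M) ^ w * f) *
      ∏ i : Fin d, MvPolynomial.X (Sum.inl i)) * h4

theorem evalAt_add_mem_gammaFil {R : Type u} [CommRing R] [LambdaRing R] {ε : R →+* ℤ}
    {n q w : ℕ} (hw : q + d = w + 1) {N : R} (hN : ∀ k, d < k → lam k N = 0) (hrank : ε N = d)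
    {Q : MvPolynomial (Fin d ⊕ ℕ) ℤ} (hQ : IsTwistedPoly.{u} d (n + 1) Q)
    {x : R} (hx : x ∈ gammaFil ε q) :
    evalAt d Q N x + (-1) ^ (n + 1) * (n + 1 : R) ^ w * x ∈ gammaFil ε (q + 1) := by
  obtain ⟨P, hP, rfl⟩ := exists_eq_intEval_of_mem_gammaFil d N hx
  obtain ⟨G, hG⟩ := ((IsUniversal.poly P).evalAt Q).add
    ((IsUniversal.intCast ((-1) ^ (n + 1) * (n + 1) ^ w)).mul (IsUniversal.poly P))
  have hG' : Polynomial.X ^ (q + 1) ∣ weightHom (gamWt d _) G := by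
    refine X_pow_dvd_weightHom_of_gen fun M => ?_
    rw [← hG _ _ _ fun k => lam_genN]
    simpa using X_pow_dvd_gen hw hQ (intEval_gen_mem_varIdeal_pow (M := M) hP)
  have h := intEval_mem_gammaFil hrank hG'
  rw [← hG _ _ _ hN] at h
  simpa using h

end Main

end LambdaRing

open PreLambdaRing LambdaRing in
theorem mainTheorem9 {R : Type u} [CommRing R] [LambdaRing R]
    (ε : R →+* ℤ) (hε : IsAugmentation ε)
    (d q n : ℕ) (hn : 1 ≤ n) (hdq : 1 ≤ q + d)
    (N : R) (hN : ∀ k, d < k → lam k N = 0) (hrank : ε N = d)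
    (x : R) (hx : x ∈ gammaFil ε q) :
    (∃! Q : MvPolynomial (Fin d ⊕ ℕ) ℤ, IsTwistedPoly.{u} d n Q) ∧
      twistedLam d n N x + (-1) ^ n * (n : R) ^ (q + d - 1) * x ∈ gammaFil ε (q + 1) := by
  obtain ⟨n, rfl⟩ := Nat.exists_eq_add_of_le' hn
  obtain ⟨w, hw⟩ := Nat.exists_eq_add_of_le' hdq
  have hex := existsUnique_isTwistedPoly.{u} d n
  refine ⟨hex, ?_⟩
  have h := evalAt_add_mem_gammaFil hw hN hrank (Classical.epsilon_spec hex.exists) hx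
  rw [hw, Nat.add_sub_cancel, Nat.cast_succ]
  exact h
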